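/- Consider a single-server queue in a random environment. The environment $Z$ is an irreducible continuous-time Markov chain on $\{1,\dots,D\}$ with generator $Q$ and invariant distribution $\pi$. While the environment is in state $d$, customers arrive according to a Poisson process of rate $\lambda_d\ge 0$ and the server works at rate $c_d\ge 0$. A customer that arrives in state $d$ has a service requirement with distribution $H_d$ on $[0,\infty)$, which does not change afterwards; $h_{d1}$ and $h_{d2}$ are the first and second moments of $H_d$, assumed finite. Requirements, arrivals and environment are independent apart from this modulation. The service discipline is an arbitrary work-conserving one (for instance, any that does not depend on the state of the environment): as long as there is unfinished work, the whole capacity is divided among the customers with unfinished work. The workload $W$ is the total residual service requirement of the customers in the system, which is depleted at rate $c_d$ while it is positive and the environment is in state $d$. Put $$c_\infty=\sum_d\pi_d c_d,\qquad \rho_\infty=\frac1{c_\infty}\sum_d \pi_d\lambda_d h_{d1},$$ and assume $c_\infty>0$. Suppose that $(W,Z)$ is in steady state, and let $p_{0,d}=\mathbb P(W=0,\,Z=d)$. Then $$1-\rho_\infty=\sum_{d}\frac{p_{0,d}\,c_d}{c_\infty}.$$ The system of equations $$[Qa]_d=c_d-\lambda_d h_{d1}-c_\infty(1-\rho_\infty),\qquad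 d=1,\dots,D,$$ has a solution $a\in\mathbb R^D$. If moreover $\rho_\infty<1$, then $\mathbb E W<\infty$ and, for every such solution $a$, $$\mathbb E W=\frac{\sum_{d}\bigl[\pi_d\lambda_d h_{d2}/2+a_d\pi_d(\lambda_d h_{d1}-c_d)+p_{0,d}\,c_d\,a_d\bigr]}{c_\infty(1-\rho_\infty)}.$$ -/

import Mathlib

open MeasureTheory ProbabilityTheory

noncomputable section

/-- Parameters of a single-server queue in a finite Markovian random environment with states
`Fin D`: the generator `Q` of the (irreducible) environment, and for every state `d` the arrival
rate `lam d`, the service capacity `c d` and the law `H d` on `[0, ∞)` of the service requirement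
of a customer that arrives in state `d`, with finite first and second moments. -/
structure ModulatedQueue (D : ℕ) where
  Q : Matrix (Fin D) (Fin D) ℝ
  lam : Fin D → ℝ
  c : Fin D → ℝ
  H : Fin D → Measure ℝ
  Q_offDiag : ∀ d l, d ≠ l → 0 ≤ Q d l
  Q_rowSum : ∀ d, ∑ l, Q d l = 0
  Q_irreducible : ∀ d l, Relation.ReflTransGen (fun i j => 0 < Q i j) d l
  lam_nonneg : ∀ d, 0 ≤ lam d
  c_nonneg : ∀ d, 0 ≤ c d
  H_prob : ∀ d, IsProbabilityMeasure (H d)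
  H_nonneg : ∀ d, H d (Set.Iio 0) = 0
  H_first : ∀ d, Integrable (fun x : ℝ => x) (H d)
  H_second : ∀ d, Integrable (fun x : ℝ => x ^ 2) (H d)

/-- The primitive random variables that drive the queue: `interarrival d n` and `switch d l n` are
the successive gaps of unit-rate Poisson processes (one for the arrivals in state `d`, one for the
environment transitions `d → l`), `requirement d n` is the service requirement that belongs to the
`n`-th point of the arrival process of state `d`. -/
inductive Source (D : ℕ) : Type
  | interarrival (d : Fin D) (n : ℕ)
  | requirement (d : Fin D) (n : ℕ)
  | switch (d l : Fin D) (n : ℕ)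

/-- Customers: `Sum.inl i` are those present at time `0`; `Sum.inr (d, n)` is the customer that
belongs to the `n`-th point of the arrival process of state `d` (it joins the queue only if the
environment is in state `d` at that point). -/
abbrev Customer (D : ℕ) : Type := ℕ ⊕ (Fin D × ℕ)

/-- `RingsAt rate gap n t`: the `n`-th point (`n = 0, 1, …`) of the Poisson process of rate `rate`
that is built from the unit-rate gaps `gap` lies at time `t`, that is, `t` is the sum of the first
`n + 1` gaps divided by `rate`. A process of rate `0` has no points. -/
def RingsAt (rate : ℝ) (gap : ℕ → ℝ) (n : ℕ) (t : ℝ) : Prop :=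
  rate * t = ∑ i ∈ Finset.range (n + 1), gap i

namespace ModulatedQueue

variable {D : ℕ} (m : ModulatedQueue D)

/-- `π` is an invariant distribution of the environment. -/
def IsInvariantDistribution (π : Fin D → ℝ) : Prop :=
  (∀ d, 0 ≤ π d) ∧ ∑ d, π d = 1 ∧ ∀ l, ∑ d, π d * m.Q d l = 0

/-- First moment of the service requirement in state `d`. -/
def h1 (d : Fin D) : ℝ := ∫ x, x ∂(m.H d)

/-- Second moment of the service requirement in state `d`. -/
def h2 (d : Fin D) : ℝ := ∫ x, x ^ 2 ∂(m.H d)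

/-- Average service capacity. -/
def cInf (π : Fin D → ℝ) : ℝ := ∑ d, π d * m.c d

/-- Traffic intensity. -/
def rhoInf (π : Fin D → ℝ) : ℝ := (∑ d, π d * m.lam d * m.h1 d) / m.cInf π

/-- The equation `[Q a]_d = c_d - λ_d h_{d1} - c_∞ (1 - ρ_∞)` for all `d`. -/
def SolvesQ (π a : Fin D → ℝ) : Prop :=
  ∀ d, ∑ l, m.Q d l * a l = m.c d - m.lam d * m.h1 d - m.cInf π * (1 - m.rhoInf π)

/-- The laws of the primitive random variables. -/
def sourceLaw : Source D → Measure ℝ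
  | .interarrival _ _ => expMeasure 1
  | .requirement d _ => m.H d
  | .switch _ _ _ => expMeasure 1

/-- The queue with parameters `m` on the time axis `[0, ∞)`, on the probability space `(Ω, P)`,
under an arbitrary work-conserving service discipline. -/
structure Realization {Ω : Type*} [MeasurableSpace Ω] (P : Measure Ω) where
  /-- primitive random variables -/
  X : Source D → Ω → ℝ
  /-- residual requirements of the customers present at time `0` -/
  init : ℕ → Ω → ℝ
  /-- environment -/
  Z : ℝ → Ω → Fin D
  /-- residual service requirement of each customer (`0` before arrival and after departure) -/
  R : Customer D → ℝ → Ω → ℝ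
  /-- the service discipline: fraction of the capacity that is given to each customer -/
  share : Customer D → ℝ → Ω → ℝ
  X_measurable : ∀ i, Measurable (X i)
  X_law : ∀ i, P.map (X i) = m.sourceLaw i
  X_indep : iIndepFun X P
  init_measurable : ∀ i, Measurable (init i)
  Z_zero_measurable : Measurable (Z 0)
  /-- the state at time `0` is independent of the primitive random variables -/
  init_indep : IndepFun (fun ω => ((fun i => init i ω), Z 0 ω)) (fun ω i => X i ω) P
  init_nonneg : ∀ᵐ ω ∂P, ∀ i, 0 ≤ init i ω
  init_finite : ∀ᵐ ω ∂P, {i | init i ω ≠ 0}.Finite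
  /-- the environment stays in `d` as long as none of the processes `d → l` has a point -/
  Z_hold : ∀ᵐ ω ∂P, ∀ s t d, 0 ≤ s → s ≤ t → Z s ω = d →
    (∀ l, l ≠ d → ∀ n, ∀ u ∈ Set.Ioc s t,
      ¬ RingsAt (m.Q d l) (fun i => X (.switch d l i) ω) n u) →
    Z t ω = d
  /-- if it is in `d` just before a point of the process `d → l`, it moves to `l` -/
  Z_jump : ∀ᵐ ω ∂P, ∀ s t d l n, 0 ≤ s → s < t → (∀ u ∈ Set.Ico s t, Z u ω = d) → l ≠ d →
    RingsAt (m.Q d l) (fun i => X (.switch d l i) ω) n t → Z t ω = l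
  R_nonneg : ∀ᵐ ω ∂P, ∀ j t, 0 ≤ t → 0 ≤ R j t ω
  /-- residual requirement of an initial customer = initial value minus service received -/
  R_init : ∀ᵐ ω ∂P, ∀ i t, 0 ≤ t →
    R (.inl i) t ω = init i ω - ∫ s in (0 : ℝ)..t, m.c (Z s ω) * share (.inl i) s ω
  /-- a customer that has joined by time `t`: requirement minus service received -/
  R_joined : ∀ᵐ ω ∂P, ∀ d n t u, 0 < u → u ≤ t →
    RingsAt (m.lam d) (fun i => X (.interarrival d i) ω) n u → Z u ω = d →
    R (.inr (d, n)) t ω =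
      X (.requirement d n) ω - ∫ s in (0 : ℝ)..t, m.c (Z s ω) * share (.inr (d, n)) s ω
  /-- a customer that has not joined by time `t` -/
  R_notJoined : ∀ᵐ ω ∂P, ∀ d n t, 0 ≤ t →
    (∀ u ∈ Set.Ioc 0 t,
      RingsAt (m.lam d) (fun i => X (.interarrival d i) ω) n u → Z u ω ≠ d) →
    R (.inr (d, n)) t ω = 0
  share_measurable : ∀ᵐ ω ∂P, ∀ j, Measurable (fun s => share j s ω)
  share_nonneg : ∀ᵐ ω ∂P, ∀ j s, 0 ≤ s → 0 ≤ share j s ω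
  /-- only customers with unfinished work are served -/
  share_eq_zero : ∀ᵐ ω ∂P, ∀ j s, 0 ≤ s → R j s ω = 0 → share j s ω = 0
  /-- the whole capacity is used whenever there is unfinished work -/
  share_sum : ∀ᵐ ω ∂P, ∀ s, 0 ≤ s → (∃ j, 0 < R j s ω) → HasSum (fun j => share j s ω) 1

namespace Realization

variable {m} {Ω : Type*} [MeasurableSpace Ω] {P : Measure Ω} (S : m.Realization P)

/-- The workload at time `t`: the total residual service requirement in the system. -/
def W (t : ℝ) (ω : Ω) : ℝ := ∑' j, S.R j t ω

/-- The process `(W, Z)` is in steady state. -/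
def IsStationary : Prop :=
  ∀ t, 0 ≤ t →
    IdentDistrib (fun ω => (S.W t ω, S.Z t ω)) (fun ω => (S.W 0 ω, S.Z 0 ω)) P P

/-- `P(W = 0, Z = d)` in steady state. -/
def p0 (d : Fin D) : ℝ := P.real {ω | S.W 0 ω = 0 ∧ S.Z 0 ω = d}

end Realization

end ModulatedQueue

end

/-! In steady state the generator of (W, Z) has mean zero: for a family f_d of bounded functions
with bounded derivatives, the sum over d of E[Z = d; -c_d 1{W > 0} f_d'(W) + λ_d (f_d(W + B_d) -
f_d(W)) + Σ_l Q_dl f_l(W)] vanishes, where B_d has law H_d and is independent of (W, Z). This is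
`sum_integral_generator_eq_zero`; everything else is a choice of f.

Indicators of environment states show that Z has law π. The function w gives the unused capacity,
hence 1 - ρ_∞. For w²/2 + a_d w the coefficient of w on {Z = d} is (Qa)_d + λ_d h_{d1} - c_d, which
equals -c_∞(1 - ρ_∞) in every state exactly when a solves the system. So c_∞(1 - ρ_∞) E W is a sum
of moments that are already known. Solvability is the Fredholm alternative for Q
(`exists_mulVec_eq`).

These functions are unbounded and E W is not known to be finite, so they are replaced by the
truncations `truncSq` and `truncId`. As `truncId` is the derivative of `truncSq`, the same
cancellation holds at every truncation level (`sum_trunc_eq_zero`). Fatou's lemma then gives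
integrability, and dominated convergence gives the value (`integrable_V_and_integral`).

The generator equation comes from the paths. In a window of length t, outside an event of
probability O(t²), at most one clock acts, and the increment of f_Z(W) is the explicit `approx` up
to O(t) on the event that a clock rings, thus up to O(t²) in mean (`abs_sub_approx_le`). The
discipline enters only through the total service: its rate is at most the capacity, and equals it
while work remains. -/

noncomputable section

/-! ### The Poisson equation of the environment -/

namespace ModulatedQueue

variable {D : ℕ} (m : ModulatedQueue D)

/-- Maximum principle: harmonic functions of an irreducible environment are constant. -/
lemma eq_of_mulVec_eq_zero {a : Fin D → ℝ} (ha : m.Q.mulVec a = 0) (i j : Fin D) : a i = a j := by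
  have : Nonempty (Fin D) := ⟨i⟩
  obtain ⟨k, hk⟩ := Finite.exists_max a
  have step : ∀ l, Relation.ReflTransGen (fun i j => 0 < m.Q i j) k l → a l = a k := by
    intro l hl
    induction hl with
    | refl => rfl
    | @tail b e _ hbe ih =>
      have h0 : ∑ l, m.Q b l * (a b - a l) = 0 := by
        have h1 : ∑ l, m.Q b l * a l = 0 := congrFun ha b
        simp_rw [mul_sub, Finset.sum_sub_distrib, ← Finset.sum_mul, m.Q_rowSum b, h1]
        simp
      have hnn : ∀ l ∈ Finset.univ, 0 ≤ m.Q b l * (a b - a l) := by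
        intro l _
        by_cases hbl : b = l
        · simp [hbl]
        · exact mul_nonneg (m.Q_offDiag b l hbl) (by rw [ih]; linarith [hk l])
      have := (Finset.sum_eq_zero_iff_of_nonneg hnn).1 h0 e (Finset.mem_univ _)
      rcases mul_eq_zero.1 this with h | h
      · exact absurd h hbe.ne'
      · linarith
  rw [step i (m.Q_irreducible k i), step j (m.Q_irreducible k j)]

/-- Fredholm alternative by dimension count. Invariance of π puts the range of Q inside the kernel
of u ↦ Σ π_d u_d, a space of dimension D - 1. By the maximum principle the kernel of Q consists of
constants, so the range has dimension at least D - 1 and the two spaces agree. -/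
lemma exists_mulVec_eq {π : Fin D → ℝ} (hπ : m.IsInvariantDistribution π) {v : Fin D → ℝ}
    (hv : ∑ d, π d * v d = 0) : ∃ a : Fin D → ℝ, m.Q.mulVec a = v := by
  obtain ⟨-, hsum, hinv⟩ := hπ
  let φ : (Fin D → ℝ) →ₗ[ℝ] ℝ := Fintype.linearCombination ℝ π
  have hφ : ∀ u, φ u = ∑ d, π d * u d := by
    intro u
    simp [φ, Fintype.linearCombination_apply, mul_comm]
  have hle : LinearMap.range m.Q.mulVecLin ≤ LinearMap.ker φ := by
    rintro _ ⟨a, rfl⟩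
    rw [LinearMap.mem_ker, hφ]
    simp only [Matrix.mulVecLin_apply, Matrix.mulVec, dotProduct, Finset.mul_sum]
    rw [Finset.sum_comm]
    simp_rw [← mul_assoc, ← Finset.sum_mul, hinv]
    simp
  have hker : Module.finrank ℝ (LinearMap.ker m.Q.mulVecLin) ≤ 1 := by
    refine finrank_le_one (⟨fun _ => 1, ?_⟩ : LinearMap.ker m.Q.mulVecLin) ?_
    · rw [LinearMap.mem_ker]
      ext d
      simpa [Matrix.mulVec, dotProduct] using m.Q_rowSum d
    · rintro ⟨a, ha⟩
      rcases isEmpty_or_nonempty (Fin D) with h | ⟨⟨i⟩⟩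
      · exact ⟨0, Subtype.ext (Subsingleton.elim _ _)⟩
      · refine ⟨a i, Subtype.ext (funext fun j => ?_)⟩
        simpa using m.eq_of_mulVec_eq_zero (by simpa using ha) i j
  have hsurj : LinearMap.range φ = ⊤ := by
    refine LinearMap.range_eq_top.2 fun r => ⟨fun _ => r, ?_⟩
    rw [hφ, ← Finset.sum_mul, hsum, one_mul]
  have h1 := LinearMap.finrank_range_add_finrank_ker m.Q.mulVecLin
  have h2 := LinearMap.finrank_range_add_finrank_ker φ
  rw [hsurj, finrank_top, Module.finrank_self] at h2
  have heq := Submodule.eq_of_le_of_finrank_le hle (by omega)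
  have : v ∈ LinearMap.range m.Q.mulVecLin := by
    rw [heq, LinearMap.mem_ker, hφ, hv]
  obtain ⟨a, ha⟩ := this
  exact ⟨a, by simpa using ha⟩

/-- The indicator of d minus π_d is centred under π, hence of the form Qa, hence centred under ν as
well. -/
lemma IsInvariantDistribution.unique {m : ModulatedQueue D} {π ν : Fin D → ℝ}
    (hπ : m.IsInvariantDistribution π) (hν : m.IsInvariantDistribution ν) : ν = π := by
  funext d
  obtain ⟨a, ha⟩ := m.exists_mulVec_eq hπ (v := fun l => (if l = d then 1 else 0) - π d) (by
    simp [mul_sub, Finset.sum_sub_distrib, ← Finset.sum_mul, hπ.2.1])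
  have h : ∑ l, ν l * ((if l = d then 1 else 0) - π d) = 0 := by
    have hl : ∀ l, (if l = d then (1 : ℝ) else 0) - π d = ∑ k, m.Q l k * a k :=
      fun l => (congrFun ha l).symm
    simp_rw [hl, Finset.mul_sum]
    rw [Finset.sum_comm]
    simp_rw [← mul_assoc, ← Finset.sum_mul, hν.2.2]
    simp
  simp [mul_sub, Finset.sum_sub_distrib, ← Finset.sum_mul, hν.2.1] at h
  linarith

lemma cInf_mul_one_sub_rhoInf {π : Fin D → ℝ} (hc : 0 < m.cInf π) :
    m.cInf π * (1 - m.rhoInf π) = ∑ d, π d * (m.c d - m.lam d * m.h1 d) := by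
  rw [rhoInf, mul_sub, mul_div_cancel₀ _ hc.ne', mul_one, cInf, ← Finset.sum_sub_distrib]
  exact Finset.sum_congr rfl fun d _ => by ring

lemma exists_solvesQ {π : Fin D → ℝ} (hπ : m.IsInvariantDistribution π) (hc : 0 < m.cInf π) :
    ∃ a : Fin D → ℝ, m.SolvesQ π a := by
  obtain ⟨a, ha⟩ := m.exists_mulVec_eq hπ
    (v := fun d => m.c d - m.lam d * m.h1 d - m.cInf π * (1 - m.rhoInf π)) (by
      simp_rw [mul_sub (π _) (_ - _), Finset.sum_sub_distrib, ← Finset.sum_mul, hπ.2.1,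
        m.cInf_mul_one_sub_rhoInf hc]
      simp)
  exact ⟨a, fun d => congrFun ha d⟩

end ModulatedQueue


/-! ### Poisson clocks and their rates -/

/-- The Poisson clocks of the model: one for the arrivals in each state of the environment and one
for each transition. -/
abbrev Clock (D : ℕ) : Type := Fin D ⊕ (Fin D × Fin D)

/-- The `n`-th unit-rate gap of a clock. -/
def Clock.gap {D : ℕ} : Clock D → ℕ → Source D
  | .inl d, n => .interarrival d n
  | .inr (d, l), n => .switch d l n

namespace ModulatedQueue

variable {D : ℕ} (m : ModulatedQueue D)

/-- The rate of a clock; the clocks `d → d` never ring. -/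
def rate : Clock D → ℝ
  | .inl d => m.lam d
  | .inr (d, l) => max (m.Q d l) 0

lemma rate_nonneg (p : Clock D) : 0 ≤ m.rate p := by
  rcases p with d | ⟨d, l⟩
  · exact m.lam_nonneg d
  · exact le_max_right _ _

lemma rate_switch {d l : Fin D} (h : d ≠ l) : m.rate (.inr (d, l)) = m.Q d l :=
  max_eq_left (m.Q_offDiag d l h)

/-- An upper bound for the service capacities. -/
def cMax : ℝ := ∑ d, m.c d

lemma c_le_cMax (d : Fin D) : m.c d ≤ m.cMax :=
  Finset.single_le_sum (fun i _ => m.c_nonneg i) (Finset.mem_univ d)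

lemma cMax_nonneg : 0 ≤ m.cMax := Finset.sum_nonneg fun i _ => m.c_nonneg i

end ModulatedQueue

lemma RingsAt.gap_zero_le {rate t : ℝ} {gap : ℕ → ℝ} {n : ℕ} (h : RingsAt rate gap n t)
    (hg : ∀ n, 0 < gap n) : gap 0 ≤ rate * t := by
  rw [h]
  exact Finset.single_le_sum (fun i _ => (hg i).le) (by simp)

/-- Every point but the first needs both initial gaps, and the first gap is positive. A second ring
is thus controlled by `gap 1` alone, whose law is explicit. -/
lemma RingsAt.gap_one_lt {rate t : ℝ} {gap : ℕ → ℝ} {n : ℕ} (h : RingsAt rate gap n t)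
    (hg : ∀ n, 0 < gap n) (hn : n ≠ 0) : gap 1 < rate * t := by
  have hsub : Finset.range 2 ⊆ Finset.range (n + 1) := Finset.range_mono (by omega)
  have := Finset.sum_le_sum_of_subset_of_nonneg hsub fun i _ _ => (hg i).le
  rw [← h, Finset.sum_range_succ, Finset.sum_range_one] at this
  linarith [hg 0]

/-! ### Pathwise bounds on the workload -/

namespace ModulatedQueue.Realization

variable {D : ℕ} {m : ModulatedQueue D} {Ω : Type*} [MeasurableSpace Ω] {P : Measure Ω}
  (S : m.Realization P)

/-- The outcomes at which all almost sure properties of a realization hold. -/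
structure IsGood (ω : Ω) : Prop where
  gap_pos : ∀ (p : Clock D) n, 0 < S.X (p.gap n) ω
  requirement_nonneg : ∀ d n, 0 ≤ S.X (.requirement d n) ω
  init_nonneg : ∀ i, 0 ≤ S.init i ω
  init_finite : {i | S.init i ω ≠ 0}.Finite
  Z_hold : ∀ s t d, 0 ≤ s → s ≤ t → S.Z s ω = d →
    (∀ l, l ≠ d → ∀ n, ∀ u ∈ Set.Ioc s t,
      ¬ RingsAt (m.Q d l) (fun i => S.X (.switch d l i) ω) n u) →
    S.Z t ω = d
  Z_jump : ∀ s t d l n, 0 ≤ s → s < t → (∀ u ∈ Set.Ico s t, S.Z u ω = d) → l ≠ d →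
    RingsAt (m.Q d l) (fun i => S.X (.switch d l i) ω) n t → S.Z t ω = l
  R_nonneg : ∀ j t, 0 ≤ t → 0 ≤ S.R j t ω
  R_init : ∀ i t, 0 ≤ t →
    S.R (.inl i) t ω = S.init i ω - ∫ s in (0 : ℝ)..t, m.c (S.Z s ω) * S.share (.inl i) s ω
  R_joined : ∀ d n t u, 0 < u → u ≤ t →
    RingsAt (m.lam d) (fun i => S.X (.interarrival d i) ω) n u → S.Z u ω = d →
    S.R (.inr (d, n)) t ω =
      S.X (.requirement d n) ω - ∫ s in (0 : ℝ)..t, m.c (S.Z s ω) * S.share (.inr (d, n)) s ω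
  R_notJoined : ∀ d n t, 0 ≤ t →
    (∀ u ∈ Set.Ioc 0 t,
      RingsAt (m.lam d) (fun i => S.X (.interarrival d i) ω) n u → S.Z u ω ≠ d) →
    S.R (.inr (d, n)) t ω = 0
  share_measurable : ∀ j, Measurable (fun s => S.share j s ω)
  share_nonneg : ∀ j s, 0 ≤ s → 0 ≤ S.share j s ω
  share_eq_zero : ∀ j s, 0 ≤ s → S.R j s ω = 0 → S.share j s ω = 0
  share_sum : ∀ s, 0 ≤ s → (∃ j, 0 < S.R j s ω) → HasSum (fun j => S.share j s ω) 1

namespace IsGood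

variable {S} {ω : Ω} (h : S.IsGood ω)
include h

lemma sum_share_le_one (F : Finset (Customer D)) {s : ℝ} (hs : 0 ≤ s) :
    ∑ j ∈ F, S.share j s ω ≤ 1 := by
  by_cases hex : ∃ j, 0 < S.R j s ω
  · exact sum_le_hasSum F (fun j _ => h.share_nonneg j s hs) (h.share_sum s hs hex)
  · push Not at hex
    rw [Finset.sum_eq_zero fun j _ =>
      h.share_eq_zero j s hs (le_antisymm (hex j) (h.R_nonneg j s hs))]
    exact zero_le_one

lemma share_intervalIntegrable (j : Customer D) {t : ℝ} (ht : 0 ≤ t) :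
    IntervalIntegrable (fun s => S.share j s ω) volume 0 t := by
  refine (intervalIntegrable_const (c := (1 : ℝ))).mono_fun'
    (h.share_measurable j).aestronglyMeasurable ?_
  rw [Set.uIoc_of_le ht]
  refine (ae_restrict_iff' measurableSet_Ioc).2 (.of_forall fun s hs => ?_)
  dsimp only
  rw [Real.norm_of_nonneg (h.share_nonneg j s hs.1.le)]
  simpa using h.sum_share_le_one {j} hs.1.le

lemma service_nonneg (j : Customer D) {t : ℝ} (ht : 0 ≤ t) :
    0 ≤ ∫ s in (0 : ℝ)..t, m.c (S.Z s ω) * S.share j s ω :=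
  intervalIntegral.integral_nonneg ht fun s hs =>
    mul_nonneg (m.c_nonneg _) (h.share_nonneg j s hs.1)

/-- The path of `Z` is not assumed measurable in time, so the left integrand may fail to be
integrable, with integral 0 by convention. The comparison needs only its nonnegativity and the
integrability of the larger function. -/
lemma service_le (j : Customer D) {t : ℝ} (ht : 0 ≤ t) :
    ∫ s in (0 : ℝ)..t, m.c (S.Z s ω) * S.share j s ω ≤
      ∫ s in (0 : ℝ)..t, m.cMax * S.share j s ω := by
  rw [intervalIntegral.integral_of_le ht, intervalIntegral.integral_of_le ht]
  refine integral_mono_of_nonneg ?_ ?_ ?_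
  · exact (ae_restrict_iff' measurableSet_Ioc).2 (.of_forall fun s hs =>
      mul_nonneg (m.c_nonneg _) (h.share_nonneg j s hs.1.le))
  · exact ((intervalIntegrable_iff_integrableOn_Ioc_of_le ht).1
      (h.share_intervalIntegrable j ht)).const_mul _
  · exact (ae_restrict_iff' measurableSet_Ioc).2 (.of_forall fun s hs =>
      mul_le_mul_of_nonneg_right (m.c_le_cMax _) (h.share_nonneg j s hs.1.le))

lemma sum_service_le (F : Finset (Customer D)) {t : ℝ} (ht : 0 ≤ t) :
    ∑ j ∈ F, ∫ s in (0 : ℝ)..t, m.c (S.Z s ω) * S.share j s ω ≤ m.cMax * t := by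
  refine (Finset.sum_le_sum fun j _ => h.service_le j ht).trans ?_
  simp_rw [intervalIntegral.integral_const_mul, ← Finset.mul_sum]
  rw [← intervalIntegral.integral_finsetSum fun j _ => h.share_intervalIntegrable j ht]
  refine mul_le_mul_of_nonneg_left ?_ m.cMax_nonneg
  have := intervalIntegral.integral_mono_on ht
    (IntervalIntegrable.sum F fun j _ => h.share_intervalIntegrable j ht)
    (intervalIntegrable_const (c := (1 : ℝ)))
    (fun s hs => by simpa using h.sum_share_le_one F hs.1)
  simpa using this

/-- The workload is the work brought in minus the service given. Since the shares add up to at most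
1, the latter lies between 0 and `m.cMax * t` under any discipline. -/
lemma W_bounds (F : Finset (Customer D)) (e : Customer D → ℝ) {t : ℝ} (ht : 0 ≤ t)
    (hF : ∀ j ∉ F, S.R j t ω = 0)
    (he : ∀ j ∈ F, S.R j t ω = e j - ∫ s in (0 : ℝ)..t, m.c (S.Z s ω) * S.share j s ω) :
    ∑ j ∈ F, e j - m.cMax * t ≤ S.W t ω ∧ S.W t ω ≤ ∑ j ∈ F, e j := by
  rw [W, tsum_eq_sum hF, Finset.sum_congr rfl he, Finset.sum_sub_distrib]
  exact ⟨sub_le_sub_left (h.sum_service_le F ht) _,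
    sub_le_self _ (Finset.sum_nonneg fun j _ => h.service_nonneg j ht)⟩

lemma W_nonneg {t : ℝ} (ht : 0 ≤ t) : 0 ≤ S.W t ω := tsum_nonneg fun j => h.R_nonneg j t ht

/-- The initial customers with unfinished work. -/
def initial : Finset (Customer D) := h.init_finite.toFinset.map ⟨Sum.inl, Sum.inl_injective⟩

lemma R_inl_eq_zero {i : ℕ} (hi : Sum.inl i ∉ h.initial) {t : ℝ} (ht : 0 ≤ t) :
    S.R (.inl i) t ω = 0 := by
  have hi0 : S.init i ω = 0 := by simpa [initial] using hi
  have := h.R_init i t ht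
  linarith [h.R_nonneg (.inl i) t ht, h.service_nonneg (.inl i) ht]

/-- The requirement of a customer that has joined. -/
def requirement (_ : S.IsGood ω) : Customer D → ℝ
  | .inl i => S.init i ω
  | .inr (d, n) => S.X (.requirement d n) ω

omit h in
lemma R_of_mem_initial (h : S.IsGood ω) {j : Customer D} (hj : j ∈ h.initial) {t : ℝ}
    (ht : 0 ≤ t) :
    S.R j t ω = h.requirement j - ∫ s in (0 : ℝ)..t, m.c (S.Z s ω) * S.share j s ω := by
  obtain ⟨i, -, rfl⟩ := Finset.mem_map.1 hj
  exact h.R_init i t ht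

lemma W_zero : S.W 0 ω = ∑ j ∈ h.initial, h.requirement j := by
  rw [W, tsum_eq_sum (s := h.initial)]
  · exact Finset.sum_congr rfl fun j hj => by simpa using h.R_of_mem_initial hj le_rfl
  · rintro (i | ⟨d, n⟩) hj
    · exact h.R_inl_eq_zero hj le_rfl
    · exact h.R_notJoined d n 0 le_rfl (by simp)

/-- No measurability or independence is assumed of `R`. This form depends on `init` only and is
measurable in ω without any finiteness condition. -/
lemma W_zero_eq_tsum : S.W 0 ω = (∑' i, ENNReal.ofReal (S.init i ω)).toReal := by
  rw [h.W_zero, tsum_eq_sum (s := h.init_finite.toFinset), initial, Finset.sum_map,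
    ENNReal.toReal_sum (by simp)]
  · exact Finset.sum_congr rfl fun i _ => (ENNReal.toReal_ofReal (h.init_nonneg i)).symm
  · intro i hi
    have : S.init i ω = 0 := by simpa using hi
    simp [this]

/-- Without arrivals that join, the workload does not grow and is depleted at most at the maximal
rate. -/
lemma W_bounds_of_noJoin {t : ℝ} (ht : 0 ≤ t) (hj : ∀ d n, S.R (.inr (d, n)) t ω = 0) :
    S.W 0 ω - m.cMax * t ≤ S.W t ω ∧ S.W t ω ≤ S.W 0 ω := by
  rw [h.W_zero]
  refine h.W_bounds h.initial h.requirement ht ?_ fun j hj => h.R_of_mem_initial hj ht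
  rintro (i | ⟨d, n⟩) hi
  · exact h.R_inl_eq_zero hi ht
  · exact hj d n

lemma W_bounds_of_join {t : ℝ} (ht : 0 ≤ t) (d : Fin D)
    (hd : S.R (.inr (d, 0)) t ω = S.X (.requirement d 0) ω -
      ∫ s in (0 : ℝ)..t, m.c (S.Z s ω) * S.share (.inr (d, 0)) s ω)
    (hj : ∀ d' n, (d', n) ≠ (d, 0) → S.R (.inr (d', n)) t ω = 0) :
    S.W 0 ω + S.X (.requirement d 0) ω - m.cMax * t ≤ S.W t ω ∧
      S.W t ω ≤ S.W 0 ω + S.X (.requirement d 0) ω := by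
  have hnot : Sum.inr (d, 0) ∉ h.initial := by simp [initial]
  have := h.W_bounds (Finset.cons _ h.initial hnot) h.requirement ht ?_ ?_
  · rw [Finset.sum_cons, ← h.W_zero, add_comm] at this
    exact this
  · rintro (i | ⟨d', n⟩) hi
    · exact h.R_inl_eq_zero (fun h' => hi (Finset.mem_cons_of_mem h')) ht
    · exact hj d' n fun h' => hi (by rw [h']; exact Finset.mem_cons_self _ _)
  · intro j hj
    rcases Finset.mem_cons.1 hj with rfl | hj
    · exact hd
    · exact h.R_of_mem_initial hj ht

/-- In a constant environment without arrivals the workload is depleted at constant rate. -/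
lemma W_eq_of_const {t : ℝ} (ht : 0 ≤ t) {d : Fin D} (hZ : ∀ s ∈ Set.Icc 0 t, S.Z s ω = d)
    (hj : ∀ s ∈ Set.Icc 0 t, ∀ d n, S.R (.inr (d, n)) s ω = 0) :
    S.W t ω = max (S.W 0 ω - m.c d * t) 0 := by
  have hR0 : ∀ s ∈ Set.Icc 0 t, ∀ j ∉ h.initial, S.R j s ω = 0 := by
    rintro s hs (i | ⟨d, n⟩) hi
    · exact h.R_inl_eq_zero hi hs.1
    · exact hj s hs d n
  have hW : ∀ s ∈ Set.Icc 0 t, S.W s ω =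
      S.W 0 ω - ∑ j ∈ h.initial, ∫ u in (0 : ℝ)..s, m.c d * S.share j u ω := by
    intro s hs
    rw [h.W_zero, W, tsum_eq_sum (hR0 s hs), ← Finset.sum_sub_distrib]
    refine Finset.sum_congr rfl fun j hj => ?_
    rw [h.R_of_mem_initial hj hs.1]
    congr 1
    refine intervalIntegral.integral_congr fun u hu => ?_
    rw [Set.uIcc_of_le hs.1] at hu
    simp only [hZ u ⟨hu.1, hu.2.trans hs.2⟩]
  have hint : ∀ s ∈ Set.Icc 0 t, S.W s ω =
      S.W 0 ω - m.c d * ∫ u in (0 : ℝ)..s, ∑ j ∈ h.initial, S.share j u ω := by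
    intro s hs
    rw [hW s hs, intervalIntegral.integral_finsetSum
      fun j _ => h.share_intervalIntegrable j hs.1, Finset.mul_sum]
    simp_rw [intervalIntegral.integral_const_mul]
  have hsi : IntervalIntegrable (fun u => ∑ j ∈ h.initial, S.share j u ω) volume 0 t := by
    have := IntervalIntegrable.sum h.initial fun j _ => h.share_intervalIntegrable j ht
    rwa [Finset.sum_fn] at this
  have hle : S.W 0 ω - m.c d * t ≤ S.W t ω := by
    rw [hint t ⟨ht, le_rfl⟩]
    refine sub_le_sub_left (mul_le_mul_of_nonneg_left ?_ (m.c_nonneg d)) _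
    have := intervalIntegral.integral_mono_on ht hsi
      (intervalIntegrable_const (c := (1 : ℝ))) (fun s hs => h.sum_share_le_one _ hs.1)
    simpa using this
  -- If the queue is empty at time t, the lower bound `hle` shows that the maximum is 0. Otherwise
  -- the workload, being nonincreasing, is positive on all of [0, t], and work conservation makes
  -- the shares add up to 1 throughout.
  rcases (h.W_nonneg ht).eq_or_lt with h0 | hpos
  · rw [← h0, max_eq_right (by linarith)]
  · have hanti : ∀ s ∈ Set.Icc 0 t, S.W t ω ≤ S.W s ω := by
      intro s hs
      rw [hint t ⟨ht, le_rfl⟩, hint s hs]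
      refine sub_le_sub_left (mul_le_mul_of_nonneg_left ?_ (m.c_nonneg d)) _
      refine intervalIntegral.integral_mono_interval le_rfl hs.1 hs.2 ?_ hsi
      exact (ae_restrict_iff' measurableSet_Ioc).2 (.of_forall fun u hu =>
        Finset.sum_nonneg fun j _ => h.share_nonneg j u hu.1.le)
    have hone : ∀ s ∈ Set.Icc 0 t, ∑ j ∈ h.initial, S.share j s ω = 1 := by
      intro s hs
      have hex : ∃ j, 0 < S.R j s ω := by
        by_contra! hno
        have : S.W s ω = 0 := by
          rw [W]
          simp [fun j => le_antisymm (hno j) (h.R_nonneg j s hs.1)]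
        linarith [hanti s hs]
      -- Customers outside `h.initial` have no unfinished work, hence no share, so the finite sum is
      -- the full sum.
      exact (hasSum_sum_of_ne_finset_zero fun j hj =>
        h.share_eq_zero j s hs.1 (hR0 s hs j hj)).unique (h.share_sum s hs.1 hex)
    have : ∫ u in (0 : ℝ)..t, ∑ j ∈ h.initial, S.share j u ω = t := by
      rw [intervalIntegral.integral_congr (g := fun _ => (1 : ℝ)) fun u hu =>
        hone u (by rwa [Set.uIcc_of_le ht] at hu)]
      simp
    have hWt := hint t ⟨ht, le_rfl⟩
    rw [this] at hWt
    rw [← hWt, max_eq_left hpos.le]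

end IsGood

end ModulatedQueue.Realization


/-! ### Short windows with at most one ring -/

namespace ModulatedQueue.Realization

variable {D : ℕ} {m : ModulatedQueue D} {Ω : Type*} [MeasurableSpace Ω] {P : Measure Ω}
  (S : m.Realization P)

/-- The clock `p` rings before time `t`. -/
def Ring (p : Clock D) (t : ℝ) : Set Ω := {ω | S.X (p.gap 0) ω ≤ m.rate p * t}

/-- Two clocks ring before time `t`, or one of them has two short gaps. -/
def Multiple (t : ℝ) : Set Ω :=
  (⋃ p : Clock D, S.Ring p t ∩ {ω | S.X (p.gap 1) ω ≤ m.rate p * t}) ∪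
    ⋃ p : Clock D, ⋃ q : Clock D, ⋃ _ : p ≠ q, S.Ring p t ∩ S.Ring q t

variable {S} {ω : Ω} {t : ℝ}

lemma eq_of_not_multiple (hM : ω ∉ S.Multiple t) {p q : Clock D} (hp : ω ∈ S.Ring p t)
    (hq : ω ∈ S.Ring q t) : p = q := by
  by_contra hne
  exact hM (Or.inr (Set.mem_iUnion.2 ⟨p, Set.mem_iUnion.2 ⟨q, Set.mem_iUnion.2 ⟨hne, hp, hq⟩⟩⟩))

lemma lt_gap_one_of_not_multiple (hM : ω ∉ S.Multiple t) {p : Clock D} (hp : ω ∈ S.Ring p t) :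
    m.rate p * t < S.X (p.gap 1) ω := by
  by_contra! hle
  exact hM (Or.inl (Set.mem_iUnion.2 ⟨p, hp, hle⟩))

namespace IsGood

variable (h : S.IsGood ω)
include h

lemma ring_of_ringsAt {p : Clock D} {n : ℕ} {u : ℝ} (hut : u ≤ t)
    (hr : RingsAt (m.rate p) (fun i => S.X (p.gap i) ω) n u) : ω ∈ S.Ring p t :=
  (hr.gap_zero_le (h.gap_pos p)).trans (mul_le_mul_of_nonneg_left hut (m.rate_nonneg p))

lemma ring_of_arrival {d : Fin D} {n : ℕ} {u : ℝ} (hut : u ≤ t)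
    (hr : RingsAt (m.lam d) (fun i => S.X (.interarrival d i) ω) n u) :
    ω ∈ S.Ring (.inl d) t :=
  h.ring_of_ringsAt (p := .inl d) hut hr

lemma ring_of_switch {d l : Fin D} (hdl : l ≠ d) {n : ℕ} {u : ℝ} (hut : u ≤ t)
    (hr : RingsAt (m.Q d l) (fun i => S.X (.switch d l i) ω) n u) :
    ω ∈ S.Ring (.inr (d, l)) t := by
  refine h.ring_of_ringsAt (p := .inr (d, l)) hut (n := n) ?_
  rwa [rate_switch m hdl.symm]

lemma Z_const {d : Fin D} (hd : S.Z 0 ω = d) (hs : ∀ l, l ≠ d → ω ∉ S.Ring (.inr (d, l)) t) :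
    ∀ s ∈ Set.Icc 0 t, S.Z s ω = d := fun s hst =>
  h.Z_hold 0 s d le_rfl hst.1 hd fun l hl _ _ hu hr =>
    hs l hl (h.ring_of_switch hl (hu.2.trans hst.2) hr)

lemma no_ring (ht : 0 ≤ t) {d : Fin D} (hd : S.Z 0 ω = d) (ha : ω ∉ S.Ring (.inl d) t)
    (hs : ∀ l, l ≠ d → ω ∉ S.Ring (.inr (d, l)) t) :
    S.Z t ω = d ∧ S.W t ω = max (S.W 0 ω - m.c d * t) 0 := by
  have hZ := h.Z_const hd hs
  refine ⟨hZ t ⟨ht, le_rfl⟩, h.W_eq_of_const ht hZ fun s hst d' n => ?_⟩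
  refine h.R_notJoined d' n s hst.1 fun u hu hr hZu => ?_
  rw [hZ u ⟨hu.1.le, hu.2.trans hst.2⟩] at hZu
  subst hZu
  exact ha (h.ring_of_arrival (hu.2.trans hst.2) hr)

/-- The arrival clock of d is the only one to ring, so the environment stays in d. Its second gap
exceeds the window, so customer (d, 0) is the only one that joins. -/
lemma arrival (ht : 0 ≤ t) (hM : ω ∉ S.Multiple t) {d : Fin D} (hd : S.Z 0 ω = d)
    (ha : ω ∈ S.Ring (.inl d) t) :
    S.Z t ω = d ∧ S.W 0 ω + S.X (.requirement d 0) ω - m.cMax * t ≤ S.W t ω ∧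
      S.W t ω ≤ S.W 0 ω + S.X (.requirement d 0) ω := by
  have hZ := h.Z_const (t := t) hd fun l _ hr => by
    simpa using eq_of_not_multiple hM ha hr
  have hgap : 0 < S.X (.interarrival d 0) ω := h.gap_pos (.inl d) 0
  have hle : S.X (.interarrival d 0) ω ≤ m.lam d * t := ha
  have hlam : 0 < m.lam d := by
    refine (m.lam_nonneg d).lt_of_ne fun h0 => ?_
    rw [← h0, zero_mul] at hle
    linarith
  refine ⟨hZ t ⟨ht, le_rfl⟩, h.W_bounds_of_join ht d ?_ fun d' n hne => ?_⟩
  · have hu : S.X (.interarrival d 0) ω / m.lam d ≤ t := by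
      rw [div_le_iff₀ hlam]; linarith
    have hu0 : 0 < S.X (.interarrival d 0) ω / m.lam d := div_pos hgap hlam
    refine h.R_joined d 0 t _ hu0 hu ?_ (hZ _ ⟨hu0.le, hu⟩)
    simp [RingsAt, mul_div_cancel₀ _ hlam.ne']
  · refine h.R_notJoined d' n t ht fun u hu hr hZu => ?_
    rw [hZ u ⟨hu.1.le, hu.2⟩] at hZu
    subst hZu
    have hn : n ≠ 0 := fun hn => hne (by rw [hn])
    have h1 := hr.gap_one_lt (h.gap_pos (.inl d)) hn
    have h2 : m.lam d * t < S.X (.interarrival d 1) ω := lt_gap_one_of_not_multiple hM ha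
    have h3 := mul_le_mul_of_nonneg_left hu.2 hlam.le
    exact absurd h1 (by linarith : ¬ S.X (.interarrival d 1) ω < m.lam d * u)

lemma switch (ht : 0 ≤ t) (hM : ω ∉ S.Multiple t) {d l : Fin D} (hd : S.Z 0 ω = d) (hl : l ≠ d)
    (hs : ω ∈ S.Ring (.inr (d, l)) t) :
    S.Z t ω = l ∧ S.W 0 ω - m.cMax * t ≤ S.W t ω ∧ S.W t ω ≤ S.W 0 ω := by
  have hgap : 0 < S.X (.switch d l 0) ω := h.gap_pos (.inr (d, l)) 0
  have hle : S.X (.switch d l 0) ω ≤ m.Q d l * t := by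
    rw [← rate_switch m hl.symm]; exact hs
  have hQ : 0 < m.Q d l := by
    refine (m.Q_offDiag d l hl.symm).lt_of_ne fun h0 => ?_
    rw [← h0, zero_mul] at hle
    linarith
  set τ := S.X (.switch d l 0) ω / m.Q d l with hτ
  have hτt : τ ≤ t := by rw [hτ, div_le_iff₀ hQ]; linarith
  have hτ0 : 0 < τ := div_pos hgap hQ
  have hring : RingsAt (m.Q d l) (fun i => S.X (.switch d l i) ω) 0 τ := by
    simp [RingsAt, hτ, mul_div_cancel₀ _ hQ.ne']
  -- A clock d → k that rings before τ must be d → l itself, because no two clocks ring; but the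
  -- first point of that clock is τ.
  have hbefore : ∀ u ∈ Set.Ico 0 τ, S.Z u ω = d := by
    intro u hu
    refine h.Z_hold 0 u d le_rfl hu.1 hd fun k hk n v hv hr => ?_
    have hkl : k = l := by
      simpa using eq_of_not_multiple hM
        (h.ring_of_switch hk (hv.2.trans (hu.2.le.trans hτt)) hr) hs
    subst hkl
    have h1 : S.X (.switch d k 0) ω ≤ m.Q d k * v := hr.gap_zero_le (h.gap_pos (.inr (d, k)))
    have h2 : τ ≤ v := by rw [hτ, div_le_iff₀ hQ]; linarith
    linarith [hv.2, hu.2]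
  have hZτ : S.Z τ ω = l := h.Z_jump 0 τ d l 0 le_rfl hτ0 hbefore hl hring
  -- Leaving l again would require a clock that starts in l ≠ d, hence a second ringing clock.
  have hZt : S.Z t ω = l := by
    refine h.Z_hold τ t l hτ0.le hτt hZτ fun k hk n v hv hr => ?_
    have := eq_of_not_multiple hM (h.ring_of_switch hk hv.2 hr) hs
    simp only [Sum.inr.injEq, Prod.mk.injEq] at this
    exact hl this.1
  refine ⟨hZt, h.W_bounds_of_noJoin ht fun d' n => ?_⟩
  refine h.R_notJoined d' n t ht fun u hu hr _ => ?_
  simpa using eq_of_not_multiple hM (h.ring_of_arrival hu.2 hr) hs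

end IsGood

end ModulatedQueue.Realization


/-! ### Independence and probabilities of rings -/

/-- The hypotheses make the law of (U, A, B) the product of its three marginals, and the factors of
a product measure may be permuted and regrouped. -/
lemma ProbabilityTheory.IndepFun.prodMk_of_prodMk {Ω α β γ : Type*} [MeasurableSpace Ω]
    [MeasurableSpace α] [MeasurableSpace β] [MeasurableSpace γ] {P : Measure Ω}
    [IsProbabilityMeasure P] {U : Ω → α} {A : Ω → β} {B : Ω → γ} (hU : Measurable U)
    (hA : Measurable A) (hB : Measurable B) (hUAB : IndepFun U (fun ω => (A ω, B ω)) P)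
    (hAB : IndepFun A B P) : IndepFun A (fun ω => (U ω, B ω)) P := by
  have hUB : IndepFun U B P := hUAB.comp measurable_id measurable_snd
  have := Measure.isProbabilityMeasure_map (μ := P) hU.aemeasurable
  have := Measure.isProbabilityMeasure_map (μ := P) hA.aemeasurable
  have := Measure.isProbabilityMeasure_map (μ := P) hB.aemeasurable
  rw [indepFun_iff_map_prod_eq_prod_map_map hA.aemeasurable (hU.prodMk hB).aemeasurable,
    hUB.map_prod_eq_prod_map_map hU.aemeasurable hB.aemeasurable]
  have h1 := hUAB.map_prod_eq_prod_map_map hU.aemeasurable (hA.prodMk hB).aemeasurable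
  rw [hAB.map_prod_eq_prod_map_map hA.aemeasurable hB.aemeasurable] at h1
  have hmp : MeasurePreserving (fun x : α × β × γ => (x.2.1, x.1, x.2.2))
      ((P.map U).prod ((P.map A).prod (P.map B))) ((P.map A).prod ((P.map U).prod (P.map B))) :=
    (measurePreserving_prodAssoc (P.map A) (P.map U) (P.map B)).comp
      ((Measure.measurePreserving_swap.prod (MeasurePreserving.id (P.map B))).comp
        (measurePreserving_prodAssoc (P.map U) (P.map A) (P.map B)).symm)
  rw [← hmp.map_eq, ← h1, Measure.map_map hmp.measurable (hU.prodMk (hA.prodMk hB))]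
  rfl

lemma Clock.gap_injective {D : ℕ} {p q : Clock D} {n k : ℕ} (h : p.gap n = q.gap k) :
    p = q ∧ n = k := by
  rcases p with d | ⟨d, l⟩ <;> rcases q with d' | ⟨d', l'⟩ <;> simp_all [Clock.gap]

lemma Clock.gap_ne_requirement {D : ℕ} (p : Clock D) (n : ℕ) (d : Fin D) (k : ℕ) :
    p.gap n ≠ .requirement d k := by
  rcases p with d | ⟨d, l⟩ <;> simp [Clock.gap]

lemma one_sub_exp_neg_tendsto (r : ℝ) :
    Filter.Tendsto (fun t : ℝ => t⁻¹ * (1 - Real.exp (-(r * t)))) (nhdsWithin 0 (Set.Ioi 0))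
      (nhds r) := by
  have h : HasDerivAt (fun t : ℝ => 1 - Real.exp (-(r * t))) r 0 := by
    have h1 : HasDerivAt (fun t : ℝ => -(r * t)) (-r) 0 := by
      simp_rw [← neg_mul]
      simpa using (hasDerivAt_id (0 : ℝ)).const_mul (-r)
    simpa using h1.exp.const_sub 1
  simpa using h.tendsto_slope_zero_right

namespace ModulatedQueue.Realization

variable {D : ℕ} {m : ModulatedQueue D} {Ω : Type*} [MeasurableSpace Ω] {P : Measure Ω}
  (S : m.Realization P)

lemma X_gap_law (p : Clock D) (n : ℕ) : P.map (S.X (p.gap n)) = expMeasure 1 := by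
  rw [S.X_law]
  rcases p with d | ⟨d, l⟩ <;> rfl

lemma measureReal_gap_le (p : Clock D) (n : ℕ) {x : ℝ} (hx : 0 ≤ x) :
    P.real {ω | S.X (p.gap n) ω ≤ x} = 1 - Real.exp (-x) := by
  have := isProbabilityMeasure_expMeasure (r := 1) one_pos
  have h := cdf_expMeasure_eq one_pos x
  rw [cdf_eq_real, ← S.X_gap_law p n,
    map_measureReal_apply (S.X_measurable _) measurableSet_Iic] at h
  rw [if_pos hx, one_mul] at h
  exact h

lemma measureReal_gap_le_le (p : Clock D) (n : ℕ) {x : ℝ} (hx : 0 ≤ x) :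
    P.real {ω | S.X (p.gap n) ω ≤ x} ≤ x := by
  rw [S.measureReal_gap_le p n hx]
  linarith [Real.one_sub_le_exp_neg x]

lemma ae_isGood [IsProbabilityMeasure P] : ∀ᵐ ω ∂P, S.IsGood ω := by
  have hgap : ∀ᵐ ω ∂P, ∀ (p : Clock D) n, 0 < S.X (p.gap n) ω := by
    refine ae_all_iff.2 fun p => ae_all_iff.2 fun n => ?_
    have h := S.measureReal_gap_le p n le_rfl
    rw [neg_zero, Real.exp_zero, sub_self, measureReal_eq_zero_iff] at h
    simpa [ae_iff] using h
  have hreq : ∀ᵐ ω ∂P, ∀ d n, 0 ≤ S.X (.requirement d n) ω := by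
    refine ae_all_iff.2 fun d => ae_all_iff.2 fun n => ?_
    have h := m.H_nonneg d
    rw [show m.H d = P.map (S.X (.requirement d n)) from (S.X_law (.requirement d n)).symm,
      Measure.map_apply (S.X_measurable _) measurableSet_Iio] at h
    simp only [ae_iff, not_le]
    exact h
  filter_upwards [hgap, hreq, S.init_nonneg, S.init_finite, S.Z_hold, S.Z_jump, S.R_nonneg,
    S.R_init, S.R_joined, S.R_notJoined, S.share_measurable, S.share_nonneg, S.share_eq_zero,
    S.share_sum] with ω h1 h2 h3 h4 h5 h6 h7 h8 h9 h10 h11 h12 h13 h14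
  exact ⟨h1, h2, h3, h4, h5, h6, h7, h8, h9, h10, h11, h12, h13, h14⟩

/-- The workload at time `0` as a measurable function of the initial requirements. -/
def V (ω : Ω) : ℝ := (∑' i, ENNReal.ofReal (S.init i ω)).toReal

lemma V_nonneg (ω : Ω) : 0 ≤ S.V ω := ENNReal.toReal_nonneg

lemma measurable_V : Measurable S.V :=
  (Measurable.tsum fun i => (S.init_measurable i).ennreal_ofReal).ennreal_toReal

lemma measurable_Z_zero : Measurable (S.Z 0) := S.Z_zero_measurable

lemma indep_state : IndepFun (fun ω => (S.V ω, S.Z 0 ω)) (fun ω i => S.X i ω) P := by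
  have hφ : Measurable fun x : (ℕ → ℝ) × Fin D => ((∑' i, ENNReal.ofReal (x.1 i)).toReal, x.2) :=
    ((Measurable.tsum fun i =>
      ((measurable_pi_apply i).comp measurable_fst).ennreal_ofReal).ennreal_toReal).prodMk
        measurable_snd
  exact S.init_indep.comp hφ measurable_id

lemma indep_state_requirement (d : Fin D) :
    IndepFun (fun ω => (S.V ω, S.Z 0 ω)) (S.X (.requirement d 0)) P :=
  S.indep_state.comp measurable_id (measurable_pi_apply _)

/-- Pairwise independence would not suffice: the arrival term of `approx` involves the ring, the
initial state and the requirement together. -/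
lemma indep_gap [IsProbabilityMeasure P] (p : Clock D) (d : Fin D) :
    IndepFun (S.X (p.gap 0)) (fun ω => ((S.V ω, S.Z 0 ω), S.X (.requirement d 0) ω)) P := by
  refine IndepFun.prodMk_of_prodMk (S.measurable_V.prodMk S.measurable_Z_zero)
    (S.X_measurable _) (S.X_measurable _) ?_ (S.X_indep.indepFun (p.gap_ne_requirement 0 d 0))
  exact S.indep_state.comp measurable_id
    ((measurable_pi_apply (p.gap 0)).prodMk (measurable_pi_apply _))

lemma measurableSet_ring (p : Clock D) (t : ℝ) : MeasurableSet (S.Ring p t) :=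
  measurableSet_le (S.X_measurable _) measurable_const

lemma measurableSet_multiple (t : ℝ) : MeasurableSet (S.Multiple t) :=
  (MeasurableSet.iUnion fun p => (S.measurableSet_ring p t).inter
      (measurableSet_le (S.X_measurable _) measurable_const)).union
    (MeasurableSet.iUnion fun p => MeasurableSet.iUnion fun q => MeasurableSet.iUnion fun _ =>
      (S.measurableSet_ring p t).inter (S.measurableSet_ring q t))

lemma measureReal_ring {t : ℝ} (ht : 0 ≤ t) (p : Clock D) :
    P.real (S.Ring p t) = 1 - Real.exp (-(m.rate p * t)) :=
  S.measureReal_gap_le p 0 (mul_nonneg (m.rate_nonneg p) ht)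

lemma measureReal_ring_le {t : ℝ} (ht : 0 ≤ t) (p : Clock D) :
    P.real (S.Ring p t) ≤ m.rate p * t :=
  S.measureReal_gap_le_le p 0 (mul_nonneg (m.rate_nonneg p) ht)

lemma measureReal_gap_inter_le {t : ℝ} (ht : 0 ≤ t) {p q : Clock D} {n k : ℕ}
    (hne : p.gap n ≠ q.gap k) :
    P.real ({ω | S.X (p.gap n) ω ≤ m.rate p * t} ∩ {ω | S.X (q.gap k) ω ≤ m.rate q * t}) ≤
      m.rate p * m.rate q * t ^ 2 := by
  have hp := mul_nonneg (m.rate_nonneg p) ht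
  have hq := mul_nonneg (m.rate_nonneg q) ht
  have h := (S.X_indep.indepFun hne).measure_inter_preimage_eq_mul
    (Set.Iic (m.rate p * t)) (Set.Iic (m.rate q * t)) measurableSet_Iic measurableSet_Iic
  have h' : P.real ({ω | S.X (p.gap n) ω ≤ m.rate p * t} ∩
      {ω | S.X (q.gap k) ω ≤ m.rate q * t}) =
      P.real {ω | S.X (p.gap n) ω ≤ m.rate p * t} *
        P.real {ω | S.X (q.gap k) ω ≤ m.rate q * t} := by
    rw [measureReal_def, measureReal_def, measureReal_def, ← ENNReal.toReal_mul]
    exact congrArg ENNReal.toReal h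
  rw [h']
  calc _ ≤ (m.rate p * t) * (m.rate q * t) :=
        mul_le_mul (S.measureReal_gap_le_le p n hp) (S.measureReal_gap_le_le q k hq)
          measureReal_nonneg hp
    _ = _ := by ring

/-- Each event in the union asks two distinct, hence independent, gaps to be short, and each of them
costs a factor rate · t. -/
lemma measureReal_multiple_le [IsProbabilityMeasure P] {t : ℝ} (ht : 0 ≤ t) :
    P.real (S.Multiple t) ≤
      (∑ p, m.rate p * m.rate p + ∑ p, ∑ q, m.rate p * m.rate q) * t ^ 2 := by
  rw [add_mul, Finset.sum_mul, Finset.sum_mul]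
  refine (measureReal_union_le _ _).trans (add_le_add ?_ ?_)
  · refine (measureReal_iUnion_fintype_le _).trans (Finset.sum_le_sum fun p _ => ?_)
    exact S.measureReal_gap_inter_le ht fun h => by simpa using (Clock.gap_injective h).2
  · refine (measureReal_iUnion_fintype_le _).trans (Finset.sum_le_sum fun p _ => ?_)
    rw [Finset.sum_mul]
    refine (measureReal_iUnion_fintype_le _).trans (Finset.sum_le_sum fun q _ => ?_)
    by_cases hpq : p = q
    · simpa [hpq] using mul_nonneg (mul_self_nonneg (m.rate q)) (sq_nonneg t)
    · simp only [ne_eq, hpq, not_false_eq_true, Set.iUnion_true]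
      exact S.measureReal_gap_inter_le ht fun h => hpq (Clock.gap_injective h).1

/-- A clock rings independently of the state at time `0` and of the requirements. -/
lemma integral_indicator_ring_mul [IsProbabilityMeasure P] (p : Clock D) (d : Fin D) (t : ℝ)
    {F : (ℝ × Fin D) × ℝ → ℝ} (hF : Measurable F) :
    ∫ ω, (S.Ring p t).indicator 1 ω * F ((S.V ω, S.Z 0 ω), S.X (.requirement d 0) ω) ∂P =
      P.real (S.Ring p t) * ∫ ω, F ((S.V ω, S.Z 0 ω), S.X (.requirement d 0) ω) ∂P := by
  have hind := (S.indep_gap p d).comp (φ := (Set.Iic (m.rate p * t)).indicator (1 : ℝ → ℝ))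
    (measurable_one.indicator measurableSet_Iic) hF
  have hm := ((S.measurable_V.prodMk S.measurable_Z_zero).prodMk
    (S.X_measurable (.requirement d 0)))
  have h := hind.integral_fun_mul_eq_mul_integral
    ((measurable_one.indicator measurableSet_Iic).comp
      (S.X_measurable _)).aestronglyMeasurable (hF.comp hm).aestronglyMeasurable
  have h1 : ∫ ω, (S.Ring p t).indicator (1 : Ω → ℝ) ω ∂P = P.real (S.Ring p t) :=
    integral_indicator_one (S.measurableSet_ring p t)
  rw [← h1]
  exact h

end ModulatedQueue.Realization


/-! ### Test functions and the first-order increment -/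

/-- A family of bounded functions on `[0, ∞)` with bounded derivatives `f'`. -/
structure IsTestFamily {D : ℕ} (f f' : Fin D → ℝ → ℝ) (M L : ℝ) : Prop where
  measurable : ∀ d, Measurable (f d)
  measurable_deriv : ∀ d, Measurable (f' d)
  abs_apply_le : ∀ d w, 0 ≤ w → |f d w| ≤ M
  hasDerivAt : ∀ d w, 0 ≤ w → HasDerivAt (f d) (f' d w) w
  abs_deriv_le : ∀ d w, 0 ≤ w → |f' d w| ≤ L

namespace IsTestFamily

variable {D : ℕ} {f f' : Fin D → ℝ → ℝ} {M L : ℝ} (hf : IsTestFamily f f' M L)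
include hf

lemma abs_sub_le (d : Fin D) {x y : ℝ} (hx : 0 ≤ x) (hy : 0 ≤ y) :
    |f d y - f d x| ≤ L * |y - x| :=
  (convex_Ici (0 : ℝ)).norm_image_sub_le_of_norm_hasDerivWithin_le (s := Set.Ici 0)
    (fun w hw => (hf.hasDerivAt d w hw).hasDerivWithinAt) (fun w hw => hf.abs_deriv_le d w hw)
    hx hy

lemma abs_sub_le_two_mul (d l : Fin D) {x y : ℝ} (hx : 0 ≤ x) (hy : 0 ≤ y) :
    |f d y - f l x| ≤ 2 * M :=
  (abs_sub _ _).trans (by linarith [hf.abs_apply_le d y hy, hf.abs_apply_le l x hx])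

lemma bound_nonneg (d : Fin D) : 0 ≤ M := (abs_nonneg _).trans (hf.abs_apply_le d 0 le_rfl)

lemma lipschitz_nonneg (d : Fin D) : 0 ≤ L := (abs_nonneg _).trans (hf.abs_deriv_le d 0 le_rfl)

/-- For w > 0 the maximum is inactive for small t and the chain rule applies. At w = 0 it holds the
workload at 0 and there is no drift; this boundary effect is the source of the terms p_{0,d}. -/
lemma tendsto_drift (d : Fin D) {c w : ℝ} (hc : 0 ≤ c) (hw : 0 ≤ w) :
    Filter.Tendsto (fun t : ℝ => t⁻¹ * (f d (max (w - c * t) 0) - f d w))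
      (nhdsWithin 0 (Set.Ioi 0)) (nhds (-c * ((if 0 < w then 1 else 0) * f' d w))) := by
  split_ifs with hpos
  · have h1 : HasDerivAt (fun t : ℝ => w - c * t) (-c) 0 := by
      simpa using ((hasDerivAt_id (0 : ℝ)).const_mul c).const_sub w
    have h2 : HasDerivAt (fun t : ℝ => f d (w - c * t)) (f' d w * -c) 0 :=
      HasDerivAt.comp (h₂ := f d) (0 : ℝ) (by simpa using hf.hasDerivAt d w hw) h1
    have h3 := h2.tendsto_slope_zero_right
    rw [one_mul, mul_comm (-c)]
    refine h3.congr' ?_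
    have h4 : ∀ᶠ t in nhds (0 : ℝ), 0 < w - c * t :=
      h1.continuousAt.eventually (lt_mem_nhds (by simpa using hpos))
    filter_upwards [nhdsWithin_le_nhds h4] with t ht
    simp [max_eq_left ht.le]
  · have hw0 : w = 0 := le_antisymm (not_lt.1 hpos) hw
    subst hw0
    rw [zero_mul, mul_zero]
    refine tendsto_const_nhds.congr' ?_
    filter_upwards [self_mem_nhdsWithin] with t ht
    rw [max_eq_right (by rw [zero_sub]; exact neg_nonpos.2 (mul_nonneg hc (le_of_lt ht))),
      sub_self, mul_zero]

lemma abs_drift_le (d : Fin D) {c w t : ℝ} (hc : 0 ≤ c) (hw : 0 ≤ w) (ht : 0 ≤ t) :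
    |f d (max (w - c * t) 0) - f d w| ≤ L * (c * t) := by
  refine (hf.abs_sub_le d hw (le_max_right _ _)).trans
    (mul_le_mul_of_nonneg_left ?_ (hf.lipschitz_nonneg d))
  have := mul_nonneg hc ht
  rw [abs_le]
  constructor
  · linarith [le_max_left (w - c * t) 0]
  · linarith [max_le (by linarith : w - c * t ≤ w) hw]

end IsTestFamily

namespace ModulatedQueue.Realization

variable {D : ℕ} {m : ModulatedQueue D} {Ω : Type*} [MeasurableSpace Ω] {P : Measure Ω}
  (S : m.Realization P)

/-- Indicator of the event that the environment starts in `d`. -/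
def startsIn (d : Fin D) (ω : Ω) : ℝ := if S.Z 0 ω = d then 1 else 0

/-- First-order approximation of the increment of `f_Z(W)` over `[0, t]` from the initial state `d`
of the environment. -/
def approx (f : Fin D → ℝ → ℝ) (t : ℝ) (d : Fin D) (ω : Ω) : ℝ :=
  (f d (max (S.V ω - m.c d * t) 0) - f d (S.V ω)) +
    (S.Ring (.inl d) t).indicator 1 ω * (f d (S.V ω + S.X (.requirement d 0) ω) - f d (S.V ω)) +
    ∑ l, (S.Ring (.inr (d, l)) t).indicator 1 ω * (f l (S.V ω) - f d (S.V ω))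

variable {S} {f f' : Fin D → ℝ → ℝ} {M L : ℝ}

lemma IsGood.W_zero_eq_V {ω : Ω} (h : S.IsGood ω) : S.W 0 ω = S.V ω := h.W_zero_eq_tsum

/-- Crude bound: 2M for the drift, 2M for the arrival and 2M for each of the D transition clocks. -/
lemma IsGood.abs_approx_le {ω : Ω} (h : S.IsGood ω) (hf : IsTestFamily f f' M L) {t : ℝ}
    (d : Fin D) : |S.approx f t d ω| ≤ (4 + 2 * D) * M := by
  have hV := S.V_nonneg ω
  have hM := hf.bound_nonneg d
  have hind : ∀ (p : Clock D) (x : ℝ), |x| ≤ 2 * M →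
      |(S.Ring p t).indicator 1 ω * x| ≤ 2 * M := by
    intro p x hx
    rw [abs_mul]
    by_cases hp : ω ∈ S.Ring p t
    · simpa [hp] using hx
    · simpa [hp] using hM
  have h1 := hf.abs_sub_le_two_mul d d hV (le_max_right (S.V ω - m.c d * t) 0)
  have h2 := hind (.inl d) _ (hf.abs_sub_le_two_mul d d hV (add_nonneg hV
    (h.requirement_nonneg d 0)))
  have h3 : |∑ l, (S.Ring (.inr (d, l)) t).indicator 1 ω * (f l (S.V ω) - f d (S.V ω))| ≤
      D * (2 * M) := by
    refine (Finset.abs_sum_le_sum_abs _ _).trans ((Finset.sum_le_sum fun l _ =>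
      hind (.inr (d, l)) _ (hf.abs_sub_le_two_mul l d hV hV)).trans ?_)
    simp
  refine (abs_add_three _ _ _).trans ?_
  linarith

/-- Outside of the event of multiple rings the approximation is exact unless a clock rings. -/
lemma IsGood.abs_sub_approx_le {ω : Ω} (h : S.IsGood ω) (hf : IsTestFamily f f' M L) {t : ℝ}
    (ht : 0 ≤ t) :
    |f (S.Z t ω) (S.W t ω) - f (S.Z 0 ω) (S.W 0 ω) - S.approx f t (S.Z 0 ω) ω| ≤
      (6 + 2 * D) * M * (S.Multiple t).indicator 1 ω +
        2 * L * m.cMax * t * ∑ p, (S.Ring p t).indicator 1 ω := by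
  obtain ⟨d, hd⟩ : ∃ d, S.Z 0 ω = d := ⟨_, rfl⟩
  have hV := S.V_nonneg ω
  have hW := h.W_nonneg ht
  have hL := hf.lipschitz_nonneg d
  have hLc : 0 ≤ L * (m.cMax * t) := mul_nonneg hL (mul_nonneg m.cMax_nonneg ht)
  have hdrift := hf.abs_drift_le d (m.c_nonneg d) hV ht
  have hdrift' : L * (m.c d * t) ≤ L * (m.cMax * t) :=
    mul_le_mul_of_nonneg_left (mul_le_mul_of_nonneg_right (m.c_le_cMax d) ht) hL
  have hsum : 0 ≤ ∑ p, (S.Ring p t).indicator (1 : Ω → ℝ) ω :=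
    Finset.sum_nonneg fun p _ => Set.indicator_nonneg (fun _ _ => zero_le_one) _
  have hone : ∀ p, ω ∈ S.Ring p t → 1 ≤ ∑ p, (S.Ring p t).indicator (1 : Ω → ℝ) ω := by
    intro p hp
    have := Finset.single_le_sum (f := fun p => (S.Ring p t).indicator (1 : Ω → ℝ) ω)
      (fun p _ => Set.indicator_nonneg (fun _ _ => zero_le_one) _) (Finset.mem_univ p)
    simpa [hp] using this
  -- When a clock rings, two errors of size at most L · cMax · t occur: service during the window
  -- moves W away from its value after the jump, and `approx` still contains the full drift term.
  have hring : ∀ p, ω ∈ S.Ring p t → 2 * (L * (m.cMax * t)) ≤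
      2 * L * m.cMax * t * ∑ p, (S.Ring p t).indicator (1 : Ω → ℝ) ω := by
    intro p hp
    nlinarith [hone p hp]
  rw [hd, h.W_zero_eq_V]
  -- On multiple rings only boundedness is used: 2M for the increment and (4 + 2D)M for `approx`.
  by_cases hM : ω ∈ S.Multiple t
  · have h1 := h.abs_approx_le hf (t := t) d
    have h2 := hf.abs_sub_le_two_mul (S.Z t ω) d hV hW
    have h3 := abs_sub (f (S.Z t ω) (S.W t ω) - f d (S.V ω)) (S.approx f t d ω)
    simp only [hM, Set.indicator_of_mem, Pi.one_apply]
    nlinarith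
  have hne : ∀ {p q : Clock D}, ω ∈ S.Ring p t → q ≠ p → ω ∉ S.Ring q t :=
    fun hp hqp hq => hqp (eq_of_not_multiple hM hq hp)
  simp only [hM, not_false_eq_true, Set.indicator_of_notMem, mul_zero, zero_add]
  by_cases ha : ω ∈ S.Ring (.inl d) t
  · obtain ⟨hZ, h1, h2⟩ := h.arrival ht hM hd ha
    rw [h.W_zero_eq_V] at h1 h2
    have hB := h.requirement_nonneg d 0
    refine le_trans ?_ (hring _ ha)
    have h3 := hf.abs_sub_le d (add_nonneg hV hB) hW
    have h4 : L * |S.W t ω - (S.V ω + S.X (.requirement d 0) ω)| ≤ L * (m.cMax * t) :=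
      mul_le_mul_of_nonneg_left (abs_le.2 ⟨by linarith, by
        linarith [mul_nonneg m.cMax_nonneg ht]⟩) hL
    have h5 : ∀ l, ω ∉ S.Ring (.inr (d, l)) t := fun l => hne ha (by simp)
    simp only [approx, hZ, ha, h5, Set.indicator_of_mem, Set.indicator_of_notMem,
      not_false_eq_true, Pi.one_apply, one_mul, zero_mul, Finset.sum_const_zero, add_zero]
    rw [abs_le] at *
    constructor <;> linarith
  by_cases hs : ∃ l, l ≠ d ∧ ω ∈ S.Ring (.inr (d, l)) t
  · obtain ⟨l, hl, hs⟩ := hs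
    obtain ⟨hZ, h1, h2⟩ := h.switch ht hM hd hl hs
    rw [h.W_zero_eq_V] at h1 h2
    refine le_trans ?_ (hring _ hs)
    have h3 := hf.abs_sub_le l hV hW
    have h4 : L * |S.W t ω - S.V ω| ≤ L * (m.cMax * t) :=
      mul_le_mul_of_nonneg_left (abs_le.2 ⟨by linarith, by
        linarith [mul_nonneg m.cMax_nonneg ht]⟩) hL
    have h5 : ∑ k, (S.Ring (.inr (d, k)) t).indicator 1 ω * (f k (S.V ω) - f d (S.V ω)) =
        f l (S.V ω) - f d (S.V ω) := by
      rw [Finset.sum_eq_single l]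
      · simp [hs]
      · intro k _ hk
        have : ω ∉ S.Ring (.inr (d, k)) t := hne hs (by simpa using hk)
        simp [this]
      · simp
    rw [approx, h5]
    simp only [hZ, ha, Set.indicator_of_notMem, not_false_eq_true, zero_mul, add_zero]
    rw [abs_le] at *
    constructor <;> linarith
  -- No relevant clock rings: the workload is drained deterministically, so `approx` is exact. The
  -- index k = d contributes f_d - f_d = 0.
  · push Not at hs
    obtain ⟨hZ, h1⟩ := h.no_ring ht hd ha hs
    have h5 : ∑ k, (S.Ring (.inr (d, k)) t).indicator 1 ω * (f k (S.V ω) - f d (S.V ω)) = 0 := by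
      refine Finset.sum_eq_zero fun k _ => ?_
      by_cases hk : k = d
      · simp [hk]
      · simp [hs k hk]
    rw [approx, h5, hZ, h1, h.W_zero_eq_V]
    simp only [ha, Set.indicator_of_notMem, not_false_eq_true, zero_mul, add_zero, sub_self,
      abs_zero]
    nlinarith

end ModulatedQueue.Realization


/-! ### The stationary generator equation -/

namespace ModulatedQueue.Realization

variable {D : ℕ} {m : ModulatedQueue D} {Ω : Type*} [MeasurableSpace Ω] {P : Measure Ω}
  (S : m.Realization P)

lemma measurable_startsIn (d : Fin D) : Measurable (S.startsIn d) :=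
  (measurable_of_finite fun z : Fin D => if z = d then (1 : ℝ) else 0).comp S.measurable_Z_zero

lemma abs_startsIn_mul_le (d : Fin D) (ω : Ω) (x : ℝ) : |S.startsIn d ω * x| ≤ |x| := by
  by_cases hd : S.Z 0 ω = d <;> simp [startsIn, hd]

lemma integrable_startsIn_mul {d : Fin D} {g : Ω → ℝ} (hg : Integrable g P) :
    Integrable (fun ω => S.startsIn d ω * g ω) P :=
  hg.mono ((S.measurable_startsIn d).aestronglyMeasurable.mul hg.1)
    (.of_forall fun ω => S.abs_startsIn_mul_le d ω _)

lemma sum_startsIn_mul (g : Fin D → ℝ) (ω : Ω) :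
    ∑ d, S.startsIn d ω * g d = g (S.Z 0 ω) := by
  simp [startsIn]

lemma measurable_requirement_add (d : Fin D) :
    Measurable fun ω => S.V ω + S.X (.requirement d 0) ω :=
  S.measurable_V.add (S.X_measurable _)

variable {f f' : Fin D → ℝ → ℝ} {M L : ℝ}

section

variable [IsProbabilityMeasure P] (hf : IsTestFamily f f' M L)
include hf

lemma integrable_test_V (d : Fin D) : Integrable (fun ω => f d (S.V ω)) P :=
  .of_bound ((hf.measurable d).comp S.measurable_V).aestronglyMeasurable M
    (.of_forall fun ω => hf.abs_apply_le d _ (S.V_nonneg ω))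

lemma integrable_test_join (d k : Fin D) :
    Integrable (fun ω => f d (S.V ω + S.X (.requirement k 0) ω)) P := by
  refine .of_bound ((hf.measurable d).comp
    (S.measurable_requirement_add k)).aestronglyMeasurable M ?_
  filter_upwards [S.ae_isGood] with ω h
  exact hf.abs_apply_le d _ (add_nonneg (S.V_nonneg ω) (h.requirement_nonneg k 0))

lemma integrable_test_drain (d : Fin D) (x : ℝ) :
    Integrable (fun ω => f d (max (S.V ω - x) 0)) P :=
  .of_bound ((hf.measurable d).comp
    ((S.measurable_V.sub_const x).max measurable_const)).aestronglyMeasurable M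
    (.of_forall fun _ => hf.abs_apply_le d _ (le_max_right _ _))

omit hf [IsProbabilityMeasure P] in
lemma integrable_indicator_ring_mul (p : Clock D) (t : ℝ) {g : Ω → ℝ} (hg : Integrable g P) :
    Integrable (fun ω => (S.Ring p t).indicator 1 ω * g ω) P := by
  have := hg.indicator (S.measurableSet_ring p t)
  refine this.congr (.of_forall fun ω => ?_)
  by_cases h : ω ∈ S.Ring p t <;> simp [h]

omit hf in
lemma integral_ring_startsIn_mul (p : Clock D) (d k : Fin D) (t : ℝ) {F : ℝ → ℝ → ℝ}
    (hF : Measurable fun x : ℝ × ℝ => F x.1 x.2) :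
    ∫ ω, S.startsIn d ω * ((S.Ring p t).indicator 1 ω *
        F (S.V ω) (S.X (.requirement k 0) ω)) ∂P =
      P.real (S.Ring p t) * ∫ ω, S.startsIn d ω * F (S.V ω) (S.X (.requirement k 0) ω) ∂P := by
  have hm : Measurable fun x : (ℝ × Fin D) × ℝ =>
      (if x.1.2 = d then (1 : ℝ) else 0) * F x.1.1 x.2 :=
    ((measurable_of_finite fun z : Fin D => if z = d then (1 : ℝ) else 0).comp
      measurable_fst.snd).mul (hF.comp (measurable_fst.fst.prodMk measurable_snd))
  refine Eq.trans ?_ (S.integral_indicator_ring_mul p k t hm)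
  refine integral_congr_ae (.of_forall fun ω => ?_)
  simp only [startsIn]
  ring

/-- The expected first-order increment. -/
lemma integral_approx (t : ℝ) :
    ∫ ω, S.approx f t (S.Z 0 ω) ω ∂P = ∑ d,
      (∫ ω, S.startsIn d ω * (f d (max (S.V ω - m.c d * t) 0) - f d (S.V ω)) ∂P +
        P.real (S.Ring (.inl d) t) * ∫ ω, S.startsIn d ω *
          (f d (S.V ω + S.X (.requirement d 0) ω) - f d (S.V ω)) ∂P +
        ∑ l, P.real (S.Ring (.inr (d, l)) t) *
          ∫ ω, S.startsIn d ω * (f l (S.V ω) - f d (S.V ω)) ∂P) := by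
  have h1 : ∀ d, Integrable (fun ω => S.startsIn d ω *
      (f d (max (S.V ω - m.c d * t) 0) - f d (S.V ω))) P := fun d =>
    S.integrable_startsIn_mul ((S.integrable_test_drain hf d _).sub (S.integrable_test_V hf d))
  have h2 : ∀ d, Integrable (fun ω => S.startsIn d ω * ((S.Ring (.inl d) t).indicator 1 ω *
      (f d (S.V ω + S.X (.requirement d 0) ω) - f d (S.V ω)))) P := fun d =>
    S.integrable_startsIn_mul (S.integrable_indicator_ring_mul _ t
      ((S.integrable_test_join hf d d).sub (S.integrable_test_V hf d)))
  have h3 : ∀ d l, Integrable (fun ω => S.startsIn d ω *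
      ((S.Ring (.inr (d, l)) t).indicator 1 ω * (f l (S.V ω) - f d (S.V ω)))) P := fun d l =>
    S.integrable_startsIn_mul (S.integrable_indicator_ring_mul _ t
      ((S.integrable_test_V hf l).sub (S.integrable_test_V hf d)))
  have heq : ∀ ω, S.approx f t (S.Z 0 ω) ω = ∑ d, S.startsIn d ω * S.approx f t d ω :=
    fun ω => (S.sum_startsIn_mul (fun d => S.approx f t d ω) ω).symm
  simp_rw [heq, approx, mul_add, Finset.mul_sum]
  refine (integral_finsetSum _ fun d _ =>
    ((h1 d).add (h2 d)).add (integrable_finsetSum _ fun l _ => h3 d l)).trans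
      (Finset.sum_congr rfl fun d _ => ?_)
  refine (integral_add ((h1 d).add (h2 d))
    (integrable_finsetSum _ fun l _ => h3 d l)).trans (congrArg₂ (· + ·)
      ((integral_add (h1 d) (h2 d)).trans (congrArg _ ?_))
      ((integral_finsetSum _ fun l _ => h3 d l).trans (Finset.sum_congr rfl fun l _ => ?_)))
  · exact S.integral_ring_startsIn_mul (.inl d) d d t (F := fun v b => f d (v + b) - f d v)
      (((hf.measurable d).comp (measurable_fst.add measurable_snd)).sub
        ((hf.measurable d).comp measurable_fst))
  · exact S.integral_ring_startsIn_mul (.inr (d, l)) d d t (F := fun v _ => f l v - f d v)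
      (((hf.measurable l).comp measurable_fst).sub ((hf.measurable d).comp measurable_fst))

omit [IsProbabilityMeasure P] in
lemma measurable_approx (t : ℝ) : Measurable fun ω => S.approx f t (S.Z 0 ω) ω := by
  have heq : ∀ ω, S.approx f t (S.Z 0 ω) ω = ∑ d, S.startsIn d ω * S.approx f t d ω :=
    fun ω => (S.sum_startsIn_mul (fun d => S.approx f t d ω) ω).symm
  simp_rw [heq]
  have hV := fun d => (hf.measurable d).comp S.measurable_V
  have hR := fun p => (measurable_one : Measurable (1 : Ω → ℝ)).indicator (S.measurableSet_ring p t)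
  refine Finset.measurable_sum _ fun d _ => (S.measurable_startsIn d).mul ((Measurable.add
    (((hf.measurable d).comp ((S.measurable_V.sub_const _).max measurable_const)).sub (hV d))
    ((hR _).mul (((hf.measurable d).comp (S.measurable_requirement_add d)).sub (hV d)))).add
      (Finset.measurable_sum _ fun l _ => (hR _).mul ((hV l).sub (hV d))))

/-- In steady state the expected first-order increment is of second order. -/
lemma abs_integral_approx_le (hS : S.IsStationary) : ∃ K : ℝ, ∀ t, 0 ≤ t →
    |∫ ω, S.approx f t (S.Z 0 ω) ω ∂P| ≤ K * t ^ 2 := by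
  rcases isEmpty_or_nonempty (Fin D) with hD | ⟨⟨d₀⟩⟩
  · refine ⟨0, fun t _ => ?_⟩
    rw [S.integral_approx hf]
    simp
  have hM := hf.bound_nonneg d₀
  have hL := hf.lipschitz_nonneg d₀
  refine ⟨(6 + 2 * D) * M * (∑ p, m.rate p * m.rate p + ∑ p, ∑ q, m.rate p * m.rate q) +
    2 * L * m.cMax * ∑ p, m.rate p, fun t ht => ?_⟩
  have hmeas : Measurable fun x : ℝ × Fin D => f x.2 x.1 :=
    measurable_from_prod_countable_left fun d => hf.measurable d
  have hid := (hS t ht).comp hmeas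
  -- Almost everywhere measurability of (W_s, Z_s) is taken from the `IdentDistrib` in the
  -- stationarity hypothesis.
  have hint : ∀ s, 0 ≤ s → Integrable (fun ω => f (S.Z s ω) (S.W s ω)) P := by
    intro s hs
    refine .of_bound ((hS s hs).comp hmeas).aemeasurable_fst.aestronglyMeasurable M ?_
    filter_upwards [S.ae_isGood] with ω h
    exact hf.abs_apply_le _ _ (h.W_nonneg hs)
  have happrox : Integrable (fun ω => S.approx f t (S.Z 0 ω) ω) P := by
    refine .of_bound (S.measurable_approx hf t).aestronglyMeasurable ((4 + 2 * D) * M) ?_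
    filter_upwards [S.ae_isGood] with ω h
    exact h.abs_approx_le hf _
  -- Stationarity is used here: the increment of f_Z(W) has mean zero, so the mean of `approx` is
  -- minus the mean of the approximation error.
  have hzero : ∫ ω, (f (S.Z t ω) (S.W t ω) - f (S.Z 0 ω) (S.W 0 ω)) ∂P = 0 := by
    rw [integral_sub (hint t ht) (hint 0 le_rfl), sub_eq_zero]
    exact hid.integral_eq
  have hsub := integral_sub ((hint t ht).sub (hint 0 le_rfl)) happrox
  simp only [Pi.sub_apply] at hsub
  rw [hzero, zero_sub] at hsub
  rw [← abs_neg, ← hsub]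
  have hi1 : Integrable ((S.Multiple t).indicator (1 : Ω → ℝ)) P :=
    (integrable_const (1 : ℝ)).indicator (S.measurableSet_multiple t)
  have hi2 : ∀ p, Integrable ((S.Ring p t).indicator (1 : Ω → ℝ)) P := fun p =>
    (integrable_const (1 : ℝ)).indicator (S.measurableSet_ring p t)
  have hi3 : Integrable (fun ω => ∑ p, (S.Ring p t).indicator (1 : Ω → ℝ) ω) P :=
    integrable_finsetSum _ fun p _ => hi2 p
  calc _ ≤ ∫ ω, ((6 + 2 * D) * M * (S.Multiple t).indicator 1 ω +
        2 * L * m.cMax * t * ∑ p, (S.Ring p t).indicator 1 ω) ∂P := by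
        rw [← Real.norm_eq_abs]
        refine norm_integral_le_of_norm_le ((hi1.const_mul ((6 + 2 * D) * M)).add
          (hi3.const_mul (2 * L * m.cMax * t))) ?_
        filter_upwards [S.ae_isGood] with ω h
        exact h.abs_sub_approx_le hf ht
    _ = (6 + 2 * D) * M * P.real (S.Multiple t) +
        2 * L * m.cMax * t * ∑ p, P.real (S.Ring p t) := by
        rw [integral_add (hi1.const_mul _) (hi3.const_mul _), integral_const_mul,
          integral_const_mul, integral_finsetSum _ fun p _ => hi2 p,
          integral_indicator_one (S.measurableSet_multiple t)]
        simp_rw [fun p => integral_indicator_one (μ := P) (S.measurableSet_ring p t)]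
    _ ≤ (6 + 2 * D) * M *
          ((∑ p, m.rate p * m.rate p + ∑ p, ∑ q, m.rate p * m.rate q) * t ^ 2) +
        2 * L * m.cMax * t * ∑ p, m.rate p * t := by
        have := m.cMax_nonneg
        gcongr with p
        · exact S.measureReal_multiple_le ht
        · exact S.measureReal_ring_le ht p
    _ = _ := by
        rw [← Finset.sum_mul]
        ring

/-- Dominated convergence: by the Lipschitz bound the difference quotients are at most `L * m.c d`.
-/
lemma tendsto_integral_drift (d : Fin D) :
    Filter.Tendsto (fun t : ℝ => t⁻¹ *
        ∫ ω, S.startsIn d ω * (f d (max (S.V ω - m.c d * t) 0) - f d (S.V ω)) ∂P)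
      (nhdsWithin 0 (Set.Ioi 0))
      (nhds (-m.c d * ∫ ω, S.startsIn d ω *
        ((if 0 < S.V ω then 1 else 0) * f' d (S.V ω)) ∂P)) := by
  simp_rw [← integral_const_mul]
  refine tendsto_integral_filter_of_dominated_convergence (fun _ => L * m.c d) ?_ ?_
    (integrable_const _) ?_
  · refine .of_forall fun t => ?_
    exact ((S.integrable_startsIn_mul ((S.integrable_test_drain hf d _).sub
      (S.integrable_test_V hf d))).const_mul _).1
  · filter_upwards [self_mem_nhdsWithin] with t ht
    refine .of_forall fun ω => ?_
    have ht : 0 < t := ht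
    rw [Real.norm_eq_abs, abs_mul, abs_of_pos (inv_pos.2 ht)]
    have := (S.abs_startsIn_mul_le d ω _).trans
      (hf.abs_drift_le d (m.c_nonneg d) (S.V_nonneg ω) ht.le)
    calc _ ≤ t⁻¹ * (L * (m.c d * t)) :=
          mul_le_mul_of_nonneg_left this (inv_pos.2 ht).le
      _ = L * m.c d := by field_simp
  · refine .of_forall fun ω => ?_
    have h := (hf.tendsto_drift d (m.c_nonneg d) (S.V_nonneg ω)).const_mul (S.startsIn d ω)
    convert h using 2
    · ring
    · ring

omit hf [IsProbabilityMeasure P] in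
lemma tendsto_measureReal_ring (p : Clock D) :
    Filter.Tendsto (fun t : ℝ => t⁻¹ * P.real (S.Ring p t)) (nhdsWithin 0 (Set.Ioi 0))
      (nhds (m.rate p)) := by
  refine (one_sub_exp_neg_tendsto (m.rate p)).congr' ?_
  filter_upwards [self_mem_nhdsWithin] with t ht
  rw [S.measureReal_ring (le_of_lt ht)]

/-- The generator of `(W, Z)` has mean zero in steady state. -/
theorem sum_integral_generator_eq_zero (hS : S.IsStationary) :
    ∑ d, (-m.c d * ∫ ω, S.startsIn d ω * ((if 0 < S.V ω then 1 else 0) * f' d (S.V ω)) ∂P +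
      m.lam d * ∫ ω, S.startsIn d ω *
        (f d (S.V ω + S.X (.requirement d 0) ω) - f d (S.V ω)) ∂P +
      ∑ l, m.Q d l * ∫ ω, S.startsIn d ω * f l (S.V ω) ∂P) = 0 := by
  obtain ⟨K, hK⟩ := S.abs_integral_approx_le hf hS
  have hlim1 : Filter.Tendsto (fun t : ℝ => t⁻¹ * ∫ ω, S.approx f t (S.Z 0 ω) ω ∂P)
      (nhdsWithin 0 (Set.Ioi 0)) (nhds 0) := by
    have hKt : Filter.Tendsto (fun t : ℝ => K * t) (nhdsWithin 0 (Set.Ioi 0)) (nhds 0) := by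
      have : Filter.Tendsto (fun t : ℝ => K * t) (nhds 0) (nhds (K * 0)) :=
        (continuous_const.mul continuous_id).tendsto 0
      rw [mul_zero] at this
      exact this.mono_left nhdsWithin_le_nhds
    refine squeeze_zero_norm' ?_ hKt
    filter_upwards [self_mem_nhdsWithin] with t ht
    have ht : 0 < t := ht
    rw [norm_mul, Real.norm_of_nonneg (inv_pos.2 ht).le, Real.norm_eq_abs]
    calc _ ≤ t⁻¹ * (K * t ^ 2) := mul_le_mul_of_nonneg_left (hK t ht.le) (inv_pos.2 ht).le
      _ = K * t := by field_simp
  have hlim2 : Filter.Tendsto (fun t : ℝ => t⁻¹ * ∫ ω, S.approx f t (S.Z 0 ω) ω ∂P)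
      (nhdsWithin 0 (Set.Ioi 0))
      (nhds (∑ d,
        (-m.c d * ∫ ω, S.startsIn d ω * ((if 0 < S.V ω then 1 else 0) * f' d (S.V ω)) ∂P +
        m.rate (.inl d) * ∫ ω, S.startsIn d ω *
          (f d (S.V ω + S.X (.requirement d 0) ω) - f d (S.V ω)) ∂P +
        ∑ l, m.rate (.inr (d, l)) *
          ∫ ω, S.startsIn d ω * (f l (S.V ω) - f d (S.V ω)) ∂P))) := by
    simp_rw [S.integral_approx hf, Finset.mul_sum, mul_add, Finset.mul_sum]
    exact tendsto_finsetSum _ fun d _ => ((S.tendsto_integral_drift hf d).add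
      (((S.tendsto_measureReal_ring _).mul_const _).congr fun t => mul_assoc _ _ _)).add
      (tendsto_finsetSum _ fun l _ =>
        ((S.tendsto_measureReal_ring _).mul_const _).congr fun t => mul_assoc _ _ _)
  refine Eq.trans ?_ (tendsto_nhds_unique hlim2 hlim1)
  refine Finset.sum_congr rfl fun d _ => ?_
  congr 1
  have hsub : ∀ l, ∫ ω, S.startsIn d ω * (f l (S.V ω) - f d (S.V ω)) ∂P =
      ∫ ω, S.startsIn d ω * f l (S.V ω) ∂P - ∫ ω, S.startsIn d ω * f d (S.V ω) ∂P := by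
    intro l
    rw [← integral_sub (S.integrable_startsIn_mul (S.integrable_test_V hf l))
      (S.integrable_startsIn_mul (S.integrable_test_V hf d))]
    exact integral_congr_ae (.of_forall fun _ => mul_sub _ _ _)
  -- The clipped rate of a clock d → d may be replaced by the diagonal entry of Q since it
  -- multiplies 0; the vanishing row sums then remove the terms with f_d.
  have hrate : ∀ l, m.rate (.inr (d, l)) *
      ∫ ω, S.startsIn d ω * (f l (S.V ω) - f d (S.V ω)) ∂P =
      m.Q d l * ∫ ω, S.startsIn d ω * (f l (S.V ω) - f d (S.V ω)) ∂P := by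
    intro l
    by_cases hl : d = l
    · simp [hl]
    · rw [rate_switch m hl]
  simp_rw [hrate, hsub, mul_sub, Finset.sum_sub_distrib, ← Finset.sum_mul, m.Q_rowSum d]
  simp

end

end ModulatedQueue.Realization


/-! ### Bounded truncations of w and w²/2 -/

/-- A bounded approximation of `w` on `[0, ∞)`. -/
def truncId (ε w : ℝ) : ℝ := w / (1 + ε * w) ^ 3

/-- The derivative of `truncId`. -/
def truncIdDeriv (ε w : ℝ) : ℝ := (1 - 2 * ε * w) / (1 + ε * w) ^ 4

/-- A bounded antiderivative of `truncId`. -/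
def truncSq (ε w : ℝ) : ℝ := (w / (1 + ε * w)) ^ 2 / 2

section Truncation

variable {ε w b : ℝ}

lemma measurable_truncId (ε : ℝ) : Measurable (truncId ε) := by unfold truncId; fun_prop

lemma measurable_truncIdDeriv (ε : ℝ) : Measurable (truncIdDeriv ε) := by
  unfold truncIdDeriv; fun_prop

lemma measurable_truncSq (ε : ℝ) : Measurable (truncSq ε) := by unfold truncSq; fun_prop

lemma hasDerivAt_truncId (hε : 0 ≤ ε) (hw : 0 ≤ w) :
    HasDerivAt (truncId ε) (truncIdDeriv ε w) w := by
  have h0 : 0 < 1 + ε * w := by positivity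
  have h1 : HasDerivAt (fun w : ℝ => 1 + ε * w) ε w := by
    simpa using ((hasDerivAt_id w).const_mul ε).const_add 1
  have h2 := (hasDerivAt_id w).div (h1.pow 3) (pow_ne_zero 3 h0.ne')
  refine h2.congr_deriv ?_
  simp only [truncIdDeriv, id, Pi.pow_apply]
  field_simp
  ring

/-- With u = w / (1 + εw) one has u' = 1 / (1 + εw)², so u²/2 has derivative u u' = w / (1 + εw)³.
This explains the cube in `truncId`. -/
lemma hasDerivAt_truncSq (hε : 0 ≤ ε) (hw : 0 ≤ w) :
    HasDerivAt (truncSq ε) (truncId ε w) w := by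
  have h0 : 0 < 1 + ε * w := by positivity
  have h1 : HasDerivAt (fun w : ℝ => 1 + ε * w) ε w := by
    simpa using ((hasDerivAt_id w).const_mul ε).const_add 1
  have h2 := (((hasDerivAt_id w).div h1 h0.ne').pow 2).div_const 2
  refine h2.congr_deriv ?_
  simp only [truncId, id, Pi.div_apply, Nat.cast_ofNat, Nat.add_one_sub_one, pow_one, one_mul]
  field_simp
  ring

lemma truncId_nonneg (hε : 0 ≤ ε) (hw : 0 ≤ w) : 0 ≤ truncId ε w := by
  unfold truncId; positivity

lemma truncId_zero (ε : ℝ) : truncId ε 0 = 0 := by simp [truncId]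

lemma truncId_le (hε : 0 ≤ ε) (hw : 0 ≤ w) : truncId ε w ≤ w := by
  have h0 : 0 ≤ ε * w := by positivity
  exact div_le_self hw (one_le_pow₀ (by linarith))

lemma div_one_add_mul_le (hε : 0 < ε) (hw : 0 ≤ w) : w / (1 + ε * w) ≤ ε⁻¹ := by
  rw [div_le_iff₀ (by positivity), mul_add, ← mul_assoc, inv_mul_cancel₀ hε.ne']
  linarith [inv_pos.2 hε]

lemma truncId_le_inv (hε : 0 < ε) (hw : 0 ≤ w) : truncId ε w ≤ ε⁻¹ := by
  refine le_trans ?_ (div_one_add_mul_le hε hw)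
  have h0 : 0 ≤ ε * w := by positivity
  exact div_le_div_of_nonneg_left hw (by linarith) (le_self_pow₀ (by linarith) (by norm_num))

lemma abs_truncSq_le (hε : 0 < ε) (hw : 0 ≤ w) : |truncSq ε w| ≤ ε⁻¹ ^ 2 / 2 := by
  have h0 : 0 ≤ w / (1 + ε * w) := by positivity
  rw [truncSq, abs_of_nonneg (by positivity)]
  have := div_one_add_mul_le hε hw
  gcongr

lemma abs_truncIdDeriv_le (hε : 0 ≤ ε) (hw : 0 ≤ w) : |truncIdDeriv ε w| ≤ 1 := by
  have h0 : 0 ≤ ε * w := by positivity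
  rw [truncIdDeriv, abs_div, abs_of_pos (by positivity : 0 < (1 + ε * w) ^ 4),
    div_le_one (by positivity)]
  have h1 : (1 + ε * w) ^ 2 ≤ (1 + ε * w) ^ 4 := pow_le_pow_right₀ (by linarith) (by norm_num)
  rw [abs_le]
  constructor <;> nlinarith

lemma abs_truncId_sub_le (hε : 0 ≤ ε) {x y : ℝ} (hx : 0 ≤ x) (hy : 0 ≤ y) :
    |truncId ε y - truncId ε x| ≤ |y - x| := by
  have := (convex_Ici (0 : ℝ)).norm_image_sub_le_of_norm_hasDerivWithin_le (s := Set.Ici 0)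
    (fun w hw => (hasDerivAt_truncId hε hw).hasDerivWithinAt)
    (fun w hw => abs_truncIdDeriv_le hε hw) hx hy
  simpa using this

/-- Mean value inequality for x ↦ truncSq x - truncId(w) x on [w, w + b]: its derivative is at most
b in absolute value because `truncId` is 1-Lipschitz. The bound is uniform in ε, and it is where the
second moment is needed. -/
lemma abs_truncSq_sub_sub_le (hε : 0 ≤ ε) (hw : 0 ≤ w) (hb : 0 ≤ b) :
    |truncSq ε (w + b) - truncSq ε w - truncId ε w * b| ≤ b ^ 2 := by
  have h := (convex_Icc w (w + b)).norm_image_sub_le_of_norm_hasDerivWithin_le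
    (f := fun x => truncSq ε x - truncId ε w * x) (f' := fun x => truncId ε x - truncId ε w)
    (C := b) (fun x hx => ?_) (fun x hx => ?_) (Set.left_mem_Icc.2 (by linarith))
    (Set.right_mem_Icc.2 (by linarith))
  · rw [Real.norm_eq_abs, Real.norm_eq_abs, add_sub_cancel_left, abs_of_nonneg hb] at h
    calc _ = |truncSq ε (w + b) - truncId ε w * (w + b) - (truncSq ε w - truncId ε w * w)| := by
          congr 1; ring
      _ ≤ _ := h.trans_eq (by ring)
  · have h1 := (hasDerivAt_truncSq hε (hw.trans hx.1)).sub
      ((hasDerivAt_id x).const_mul (truncId ε w))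
    rw [mul_one] at h1
    exact h1.hasDerivWithinAt
  · refine (abs_truncId_sub_le hε hw (hw.trans hx.1)).trans ?_
    rw [abs_of_nonneg (by linarith [hx.1])]
    linarith [hx.2]

/-- A sequence of truncation levels. -/
def truncLevel (n : ℕ) : ℝ := 1 / (n + 1)

lemma truncLevel_pos (n : ℕ) : 0 < truncLevel n := Nat.one_div_pos_of_nat

lemma tendsto_truncLevel : Filter.Tendsto truncLevel Filter.atTop (nhds 0) :=
  tendsto_one_div_add_atTop_nhds_zero_nat

lemma tendsto_truncId (w : ℝ) :
    Filter.Tendsto (fun n => truncId (truncLevel n) w) Filter.atTop (nhds w) := by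
  have h : ContinuousAt (fun ε => truncId ε w) 0 := by
    unfold truncId; fun_prop (disch := simp)
  simpa [truncId, Function.comp_def] using h.tendsto.comp tendsto_truncLevel

lemma tendsto_truncIdDeriv (w : ℝ) :
    Filter.Tendsto (fun n => truncIdDeriv (truncLevel n) w) Filter.atTop (nhds 1) := by
  have h : ContinuousAt (fun ε => truncIdDeriv ε w) 0 := by
    unfold truncIdDeriv; fun_prop (disch := simp)
  simpa [truncIdDeriv, Function.comp_def] using h.tendsto.comp tendsto_truncLevel

lemma tendsto_truncSq (w : ℝ) :
    Filter.Tendsto (fun n => truncSq (truncLevel n) w) Filter.atTop (nhds (w ^ 2 / 2)) := by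
  have h : ContinuousAt (fun ε => truncSq ε w) 0 := by
    unfold truncSq; fun_prop (disch := simp)
  simpa [truncSq, Function.comp_def] using h.tendsto.comp tendsto_truncLevel

/-- The case β = 1 serves the mean workload; β = 0 with constant a serves the unused capacity. -/
lemma isTestFamily_trunc {D : ℕ} (a : Fin D → ℝ) (β : ℝ) (hε : 0 < ε) :
    IsTestFamily (fun d w => β * truncSq ε w + a d * truncId ε w)
      (fun d w => β * truncId ε w + a d * truncIdDeriv ε w)
      (|β| * (ε⁻¹ ^ 2 / 2) + (∑ d, |a d|) * ε⁻¹) (|β| * ε⁻¹ + ∑ d, |a d|) := by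
  have ha : ∀ d, |a d| ≤ ∑ d, |a d| := fun d =>
    Finset.single_le_sum (fun d _ => abs_nonneg (a d)) (Finset.mem_univ d)
  have hφ : ∀ w, 0 ≤ w → |truncId ε w| ≤ ε⁻¹ := fun w hw => by
    rw [abs_of_nonneg (truncId_nonneg hε.le hw)]
    exact truncId_le_inv hε hw
  refine ⟨fun d => ((measurable_truncSq ε).const_mul β).add ((measurable_truncId ε).const_mul _),
    fun d => ((measurable_truncId ε).const_mul β).add ((measurable_truncIdDeriv ε).const_mul _),
    fun d w hw => ?_, fun d w hw => ((hasDerivAt_truncSq hε.le hw).const_mul β).add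
      ((hasDerivAt_truncId hε.le hw).const_mul _), fun d w hw => ?_⟩
  · refine (abs_add_le _ _).trans ?_
    rw [abs_mul, abs_mul]
    exact add_le_add (mul_le_mul_of_nonneg_left (abs_truncSq_le hε hw) (abs_nonneg _))
      (mul_le_mul (ha d) (hφ w hw) (abs_nonneg _) ((abs_nonneg _).trans (ha d)))
  · refine (abs_add_le _ _).trans ?_
    rw [abs_mul, abs_mul]
    refine add_le_add (mul_le_mul_of_nonneg_left (hφ w hw) (abs_nonneg _)) ?_
    calc _ ≤ |a d| * 1 := mul_le_mul_of_nonneg_left (abs_truncIdDeriv_le hε.le hw) (abs_nonneg _)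
      _ ≤ _ := by rw [mul_one]; exact ha d

end Truncation

/-! ### Limits of the generator terms as the truncation is removed -/

namespace ModulatedQueue.Realization

variable {D : ℕ} {m : ModulatedQueue D} {Ω : Type*} [MeasurableSpace Ω] {P : Measure Ω}
  (S : m.Realization P)

lemma requirement_law (d : Fin D) : P.map (S.X (.requirement d 0)) = m.H d := S.X_law _

lemma integrable_requirement (d : Fin D) : Integrable (S.X (.requirement d 0)) P := by
  have h := m.H_first d
  rw [← S.requirement_law d] at h
  exact h.comp_measurable (S.X_measurable _)

lemma integrable_requirement_sq (d : Fin D) :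
    Integrable (fun ω => S.X (.requirement d 0) ω ^ 2) P := by
  have h := m.H_second d
  rw [← S.requirement_law d] at h
  exact h.comp_measurable (S.X_measurable _)

lemma integral_startsIn_mul_requirement (d : Fin D) {u g : ℝ → ℝ} (hu : Measurable u)
    (hg : Measurable g) :
    ∫ ω, S.startsIn d ω * (u (S.V ω) * g (S.X (.requirement d 0) ω)) ∂P =
      (∫ ω, S.startsIn d ω * u (S.V ω) ∂P) * ∫ x, g x ∂(m.H d) := by
  have hm : Measurable fun x : ℝ × Fin D => (if x.2 = d then (1 : ℝ) else 0) * u x.1 :=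
    ((measurable_of_finite fun z : Fin D => if z = d then (1 : ℝ) else 0).comp
      measurable_snd).mul (hu.comp measurable_fst)
  have h := ((S.indep_state_requirement d).comp hm hg).integral_fun_mul_eq_mul_integral
    (hm.comp (S.measurable_V.prodMk S.measurable_Z_zero)).aestronglyMeasurable
    (hg.comp (S.X_measurable _)).aestronglyMeasurable
  rw [← S.requirement_law d, integral_map (S.X_measurable _).aemeasurable
    hg.aestronglyMeasurable]
  refine Eq.trans (integral_congr_ae (.of_forall fun ω => ?_)) h
  exact (mul_assoc _ _ _).symm

variable [IsProbabilityMeasure P] (hS : S.IsStationary)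

lemma integrable_startsIn (d : Fin D) : Integrable (S.startsIn d) P := by
  simpa using S.integrable_startsIn_mul (d := d) (integrable_const (1 : ℝ))

include hS in
-- For test functions that are constant in w, the drift and arrival terms vanish and the generator
-- equation reduces to invariance under Q.
lemma isInvariantDistribution_integral_startsIn :
    m.IsInvariantDistribution fun d => ∫ ω, S.startsIn d ω ∂P := by
  refine ⟨fun d => integral_nonneg fun ω => ?_, ?_, fun l => ?_⟩
  · simp only [startsIn, Pi.zero_apply]
    split_ifs <;> simp
  · rw [← integral_finsetSum _ fun d _ => S.integrable_startsIn d]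
    simp [startsIn]
  · have hf : IsTestFamily (fun (k : Fin D) (_ : ℝ) => if k = l then (1 : ℝ) else 0)
        (fun _ _ => 0) 1 0 :=
      ⟨fun _ => measurable_const, fun _ => measurable_const,
        fun k _ _ => by split_ifs <;> simp, fun _ _ _ => hasDerivAt_const _ _, by simp⟩
    have h := S.sum_integral_generator_eq_zero hf hS
    simp_rw [integral_mul_const] at h
    simpa [mul_comm] using h

variable {π : Fin D → ℝ} (hπ : m.IsInvariantDistribution π)
include hS hπ

lemma integral_startsIn (d : Fin D) : ∫ ω, S.startsIn d ω ∂P = π d :=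
  congrFun (hπ.unique (S.isInvariantDistribution_integral_startsIn hS)) d

lemma integral_startsIn_mul_pos (d : Fin D) :
    ∫ ω, S.startsIn d ω * (if 0 < S.V ω then 1 else 0) ∂P = π d - S.p0 d := by
  have hset : MeasurableSet {ω | S.V ω = 0 ∧ S.Z 0 ω = d} :=
    (S.measurable_V (measurableSet_singleton 0)).inter
      (S.measurable_Z_zero (measurableSet_singleton d))
  have hp0 : S.p0 d = ∫ ω, {ω | S.V ω = 0 ∧ S.Z 0 ω = d}.indicator 1 ω ∂P := by
    rw [integral_indicator_one hset, p0]
    refine measureReal_congr ?_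
    filter_upwards [S.ae_isGood] with ω h
    refine propext ?_
    change S.W 0 ω = 0 ∧ S.Z 0 ω = d ↔ S.V ω = 0 ∧ S.Z 0 ω = d
    rw [h.W_zero_eq_V]
  have hint : Integrable ({ω | S.V ω = 0 ∧ S.Z 0 ω = d}.indicator (1 : Ω → ℝ)) P :=
    (integrable_const (1 : ℝ)).indicator hset
  rw [hp0, ← S.integral_startsIn hS hπ d, ← integral_sub (S.integrable_startsIn d) hint]
  refine integral_congr_ae (.of_forall fun ω => ?_)
  rcases (S.V_nonneg ω).eq_or_lt with h0 | hpos
  · by_cases hd : S.Z 0 ω = d <;> simp [startsIn, ← h0, hd]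
  · by_cases hd : S.Z 0 ω = d <;> simp [startsIn, hpos, hpos.ne', hd]

lemma integral_startsIn_mul_requirement_pow (d : Fin D) (k : ℕ) :
    ∫ ω, S.startsIn d ω * S.X (.requirement d 0) ω ^ k ∂P = π d * ∫ x, x ^ k ∂(m.H d) := by
  have h := S.integral_startsIn_mul_requirement d (u := fun _ => 1) measurable_const
    (measurable_id.pow_const k)
  simp only [one_mul, mul_one, id] at h
  rw [h, S.integral_startsIn hS hπ d]

omit hS hπ

/-- Depletion term of the generator for the truncated identity. -/
def drainTerm (S : m.Realization P) (n : ℕ) (d : Fin D) : ℝ :=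
  ∫ ω, S.startsIn d ω * ((if 0 < S.V ω then 1 else 0) * truncIdDeriv (truncLevel n) (S.V ω)) ∂P

/-- Arrival term of the generator for the truncated identity. -/
def jumpTerm (S : m.Realization P) (n : ℕ) (d : Fin D) : ℝ :=
  ∫ ω, S.startsIn d ω * (truncId (truncLevel n) (S.V ω + S.X (.requirement d 0) ω) -
    truncId (truncLevel n) (S.V ω)) ∂P

/-- Second-order part of the arrival term of the generator for the truncated square. -/
def secondOrderTerm (S : m.Realization P) (n : ℕ) (d : Fin D) : ℝ :=
  ∫ ω, S.startsIn d ω * (truncSq (truncLevel n) (S.V ω + S.X (.requirement d 0) ω) -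
    truncSq (truncLevel n) (S.V ω) -
    truncId (truncLevel n) (S.V ω) * S.X (.requirement d 0) ω) ∂P

include hS hπ

lemma tendsto_drainTerm (d : Fin D) :
    Filter.Tendsto (fun n => S.drainTerm n d) Filter.atTop (nhds (π d - S.p0 d)) := by
  rw [← S.integral_startsIn_mul_pos hS hπ d]
  have hpos : Measurable fun ω => if 0 < S.V ω then (1 : ℝ) else 0 :=
    Measurable.ite (measurableSet_lt measurable_const S.measurable_V) measurable_const
      measurable_const
  refine tendsto_integral_of_dominated_convergence (fun _ => 1) (fun n => ?_)
    (integrable_const _) (fun n => .of_forall fun ω => ?_) (.of_forall fun ω => ?_)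
  · exact ((S.measurable_startsIn d).mul (hpos.mul
      ((measurable_truncIdDeriv _).comp S.measurable_V))).aestronglyMeasurable
  · refine (S.abs_startsIn_mul_le d ω _).trans ?_
    have := abs_truncIdDeriv_le (truncLevel_pos n).le (S.V_nonneg ω)
    split_ifs
    · simpa using this
    · simp
  · simpa using ((tendsto_truncIdDeriv (S.V ω)).const_mul
      (if 0 < S.V ω then (1 : ℝ) else 0)).const_mul (S.startsIn d ω)

/-- The 1-Lipschitz bound on `truncId` makes the requirement itself a dominating function, so no
moment of W is needed. -/
lemma tendsto_jumpTerm (d : Fin D) :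
    Filter.Tendsto (fun n => S.jumpTerm n d) Filter.atTop (nhds (π d * m.h1 d)) := by
  have h := S.integral_startsIn_mul_requirement_pow hS hπ d 1
  simp only [pow_one] at h
  rw [h1, ← h]
  refine tendsto_integral_of_dominated_convergence (S.X (.requirement d 0)) (fun n => ?_)
    (S.integrable_requirement d) (fun n => ?_) (.of_forall fun ω => ?_)
  · exact ((S.measurable_startsIn d).mul (((measurable_truncId _).comp
      (S.measurable_requirement_add d)).sub
        ((measurable_truncId _).comp S.measurable_V))).aestronglyMeasurable
  · filter_upwards [S.ae_isGood] with ω hω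
    have hB := hω.requirement_nonneg d 0
    have hV := S.V_nonneg ω
    refine (S.abs_startsIn_mul_le d ω _).trans
      ((abs_truncId_sub_le (truncLevel_pos n).le hV (add_nonneg hV hB)).trans_eq ?_)
    rw [add_sub_cancel_left, abs_of_nonneg hB]
  · simpa using ((tendsto_truncId (S.V ω + S.X (.requirement d 0) ω)).sub
      (tendsto_truncId (S.V ω))).const_mul (S.startsIn d ω)

/-- The integrand tends to (v + b)²/2 - v²/2 - vb = b²/2 on {Z = d}, dominated by b². -/
lemma tendsto_secondOrderTerm (d : Fin D) :
    Filter.Tendsto (fun n => S.secondOrderTerm n d) Filter.atTop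
      (nhds (π d * m.h2 d / 2)) := by
  rw [h2, ← S.integral_startsIn_mul_requirement_pow hS hπ d 2, ← integral_div]
  refine tendsto_integral_of_dominated_convergence (fun ω => S.X (.requirement d 0) ω ^ 2)
    (fun n => ?_) (S.integrable_requirement_sq d) (fun n => ?_) (.of_forall fun ω => ?_)
  · exact ((S.measurable_startsIn d).mul ((((measurable_truncSq _).comp
      (S.measurable_requirement_add d)).sub ((measurable_truncSq _).comp S.measurable_V)).sub
        (((measurable_truncId _).comp S.measurable_V).mul
          (S.X_measurable _)))).aestronglyMeasurable
  · filter_upwards [S.ae_isGood] with ω hω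
    exact (S.abs_startsIn_mul_le d ω _).trans (abs_truncSq_sub_sub_le (truncLevel_pos n).le
      (S.V_nonneg ω) (hω.requirement_nonneg d 0))
  · have h := (((tendsto_truncSq (S.V ω + S.X (.requirement d 0) ω)).sub
      (tendsto_truncSq (S.V ω))).sub ((tendsto_truncId (S.V ω)).mul_const
        (S.X (.requirement d 0) ω))).const_mul (S.startsIn d ω)
    convert h using 2
    ring

end ModulatedQueue.Realization


/-! ### The truncated stationary equation and the mean workload -/

namespace ModulatedQueue.Realization

variable {D : ℕ} {m : ModulatedQueue D} {Ω : Type*} [MeasurableSpace Ω] {P : Measure Ω}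
  (S : m.Realization P) [IsProbabilityMeasure P]

lemma integrable_truncId_V (n : ℕ) : Integrable (fun ω => truncId (truncLevel n) (S.V ω)) P :=
  .of_bound ((measurable_truncId _).comp S.measurable_V).aestronglyMeasurable (truncLevel n)⁻¹
    (.of_forall fun ω => by
      rw [Real.norm_of_nonneg (truncId_nonneg (truncLevel_pos n).le (S.V_nonneg ω))]
      exact truncId_le_inv (truncLevel_pos n) (S.V_nonneg ω))

lemma integrable_truncSq_V (n : ℕ) : Integrable (fun ω => truncSq (truncLevel n) (S.V ω)) P :=
  .of_bound ((measurable_truncSq _).comp S.measurable_V).aestronglyMeasurable _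
    (.of_forall fun ω => abs_truncSq_le (truncLevel_pos n) (S.V_nonneg ω))

lemma integrable_truncIdDeriv_V (n : ℕ) : Integrable (fun ω =>
    (if 0 < S.V ω then 1 else 0) * truncIdDeriv (truncLevel n) (S.V ω)) P := by
  have hpos : Measurable fun ω => if 0 < S.V ω then (1 : ℝ) else 0 :=
    Measurable.ite (measurableSet_lt measurable_const S.measurable_V) measurable_const
      measurable_const
  refine .of_bound (hpos.mul
    ((measurable_truncIdDeriv _).comp S.measurable_V)).aestronglyMeasurable 1
    (.of_forall fun ω => ?_)
  have := abs_truncIdDeriv_le (truncLevel_pos n).le (S.V_nonneg ω)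
  split_ifs
  · simpa using this
  · simp

lemma integrable_jump (n : ℕ) (d : Fin D) : Integrable (fun ω =>
    truncId (truncLevel n) (S.V ω + S.X (.requirement d 0) ω) -
      truncId (truncLevel n) (S.V ω)) P := by
  refine (S.integrable_requirement d).mono' (((measurable_truncId _).comp
    (S.measurable_requirement_add d)).sub
      ((measurable_truncId _).comp S.measurable_V)).aestronglyMeasurable ?_
  filter_upwards [S.ae_isGood] with ω hω
  have hB := hω.requirement_nonneg d 0
  have hV := S.V_nonneg ω
  refine (abs_truncId_sub_le (truncLevel_pos n).le hV (add_nonneg hV hB)).trans_eq ?_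
  rw [add_sub_cancel_left, abs_of_nonneg hB]

lemma integrable_secondOrder (n : ℕ) (d : Fin D) : Integrable (fun ω =>
    truncSq (truncLevel n) (S.V ω + S.X (.requirement d 0) ω) - truncSq (truncLevel n) (S.V ω) -
      truncId (truncLevel n) (S.V ω) * S.X (.requirement d 0) ω) P := by
  refine (S.integrable_requirement_sq d).mono' ((((measurable_truncSq _).comp
    (S.measurable_requirement_add d)).sub ((measurable_truncSq _).comp S.measurable_V)).sub
      (((measurable_truncId _).comp S.measurable_V).mul
        (S.X_measurable _))).aestronglyMeasurable ?_
  filter_upwards [S.ae_isGood] with ω hω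
  exact abs_truncSq_sub_sub_le (truncLevel_pos n).le (S.V_nonneg ω) (hω.requirement_nonneg d 0)

omit [IsProbabilityMeasure P] in
lemma integrable_truncId_mul_requirement (n : ℕ) (d : Fin D) : Integrable (fun ω =>
    truncId (truncLevel n) (S.V ω) * S.X (.requirement d 0) ω) P := by
  refine (S.integrable_requirement d).bdd_mul (c := (truncLevel n)⁻¹)
    ((measurable_truncId _).comp S.measurable_V).aestronglyMeasurable (.of_forall fun ω => ?_)
  rw [Real.norm_of_nonneg (truncId_nonneg (truncLevel_pos n).le (S.V_nonneg ω))]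
  exact truncId_le_inv (truncLevel_pos n) (S.V_nonneg ω)

/-- The stationary equation for the test functions `β w² / 2 + a_d w`, truncated. -/
lemma sum_trunc_eq_zero (hS : S.IsStationary) (a : Fin D → ℝ) (β : ℝ) (n : ℕ) :
    ∑ d, ((∑ l, m.Q d l * a l + β * (m.lam d * m.h1 d - m.c d)) *
        ∫ ω, S.startsIn d ω * truncId (truncLevel n) (S.V ω) ∂P +
      (β * m.lam d * S.secondOrderTerm n d + a d * (m.lam d * S.jumpTerm n d
        - m.c d * S.drainTerm n d))) = 0 := by
  refine Eq.trans (Finset.sum_congr rfl fun d _ => ?_) (S.sum_integral_generator_eq_zero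
    (isTestFamily_trunc a β (truncLevel_pos n)) hS)
  have hF := S.integrable_startsIn_mul (d := d) (S.integrable_truncId_V n)
  have hG := S.integrable_startsIn_mul (d := d) (S.integrable_truncSq_V n)
  have hD := S.integrable_startsIn_mul (d := d) (S.integrable_truncIdDeriv_V n)
  have hJ := S.integrable_startsIn_mul (d := d) (S.integrable_jump n d)
  have hR := S.integrable_startsIn_mul (d := d) (S.integrable_secondOrder n d)
  have hB := S.integrable_startsIn_mul (d := d) (S.integrable_truncId_mul_requirement n d)
  -- The indicator of {V > 0} can be dropped from the β part since `truncId` vanishes at 0; it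
  -- survives in the part with the derivative.
  have hdrain : ∫ ω, S.startsIn d ω * ((if 0 < S.V ω then 1 else 0) *
      (β * truncId (truncLevel n) (S.V ω) + a d * truncIdDeriv (truncLevel n) (S.V ω))) ∂P =
      β * ∫ ω, S.startsIn d ω * truncId (truncLevel n) (S.V ω) ∂P +
        a d * S.drainTerm n d := by
    rw [drainTerm, ← integral_const_mul, ← integral_const_mul,
      ← integral_add (hF.const_mul β) (hD.const_mul (a d))]
    refine integral_congr_ae (.of_forall fun ω => ?_)
    rcases (S.V_nonneg ω).eq_or_lt with h0 | hpos
    · simp [← h0, truncId_zero]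
    · simp only [hpos, if_true]
      ring
  have hFB : ∫ ω, S.startsIn d ω * (truncId (truncLevel n) (S.V ω) *
      S.X (.requirement d 0) ω) ∂P =
      (∫ ω, S.startsIn d ω * truncId (truncLevel n) (S.V ω) ∂P) * m.h1 d :=
    S.integral_startsIn_mul_requirement d (measurable_truncId _) measurable_id
  have hjump : ∫ ω, S.startsIn d ω *
      (β * truncSq (truncLevel n) (S.V ω + S.X (.requirement d 0) ω) +
        a d * truncId (truncLevel n) (S.V ω + S.X (.requirement d 0) ω) -
        (β * truncSq (truncLevel n) (S.V ω) + a d * truncId (truncLevel n) (S.V ω))) ∂P =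
      β * S.secondOrderTerm n d +
        β * ((∫ ω, S.startsIn d ω * truncId (truncLevel n) (S.V ω) ∂P) * m.h1 d) +
        a d * S.jumpTerm n d := by
    rw [← hFB, secondOrderTerm, jumpTerm, ← integral_const_mul, ← integral_const_mul,
      ← integral_const_mul]
    refine Eq.trans (integral_congr_ae (.of_forall fun ω => ?_))
      ((integral_add ((hR.const_mul β).add (hB.const_mul β)) (hJ.const_mul (a d))).trans
        (congrArg (· + _) (integral_add (hR.const_mul β) (hB.const_mul β))))
    simp only [Pi.add_apply]
    ring
  have hQ : ∀ l, ∫ ω, S.startsIn d ω *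
      (β * truncSq (truncLevel n) (S.V ω) + a l * truncId (truncLevel n) (S.V ω)) ∂P =
      β * ∫ ω, S.startsIn d ω * truncSq (truncLevel n) (S.V ω) ∂P +
        a l * ∫ ω, S.startsIn d ω * truncId (truncLevel n) (S.V ω) ∂P := by
    intro l
    rw [← integral_const_mul, ← integral_const_mul,
      ← integral_add (hG.const_mul β) (hF.const_mul (a l))]
    refine integral_congr_ae (.of_forall fun ω => ?_)
    ring
  -- The `truncSq` terms do not depend on l, so the vanishing row sums of Q remove them.
  simp_rw [hdrain, hjump, hQ, mul_add (m.Q d _), Finset.sum_add_distrib, ← Finset.sum_mul,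
    m.Q_rowSum d, ← mul_assoc (m.Q d _), ← Finset.sum_mul]
  ring

variable {π : Fin D → ℝ} (hS : S.IsStationary) (hπ : m.IsInvariantDistribution π)
include hS hπ

lemma tendsto_lowerOrder (a : Fin D → ℝ) (β : ℝ) :
    Filter.Tendsto (fun n => ∑ d, (β * m.lam d * S.secondOrderTerm n d +
        a d * (m.lam d * S.jumpTerm n d - m.c d * S.drainTerm n d))) Filter.atTop
      (nhds (∑ d, (β * m.lam d * (π d * m.h2 d / 2) +
        a d * (m.lam d * (π d * m.h1 d) - m.c d * (π d - S.p0 d))))) :=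
  tendsto_finsetSum _ fun d _ => ((S.tendsto_secondOrderTerm hS hπ d).const_mul _).add
    ((((S.tendsto_jumpTerm hS hπ d).const_mul _).sub
      ((S.tendsto_drainTerm hS hπ d).const_mul _)).const_mul _)

/-- The unused capacity. -/
lemma sum_p0_mul_c :
    ∑ d, S.p0 d * m.c d = ∑ d, π d * (m.c d - m.lam d * m.h1 d) := by
  have hlim := S.tendsto_lowerOrder hS hπ (fun _ => 1) 0
  -- For constant a and β = 0 the coefficient of the integral of `truncId` is a row sum of Q, so
  -- only the lower-order terms remain.
  have hzero := S.sum_trunc_eq_zero hS (fun _ => 1) 0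
  simp only [mul_one, m.Q_rowSum, zero_mul, zero_add, one_mul] at hlim hzero
  simp_rw [hzero] at hlim
  have h := tendsto_nhds_unique hlim tendsto_const_nhds
  rw [← sub_eq_zero, ← h, ← Finset.sum_sub_distrib]
  exact Finset.sum_congr rfl fun d _ => by ring

/-- For a solution a and β = 1 the coefficient of the truncated mean is the same in every state, so
the truncated equation determines that mean outright. The remaining terms have finite limits. -/
lemma integrable_V_and_integral (hρ : 0 < m.cInf π * (1 - m.rhoInf π)) {a : Fin D → ℝ}
    (ha : m.SolvesQ π a) :
    Integrable S.V P ∧ ∫ ω, S.V ω ∂P =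
      (∑ d, (m.lam d * (π d * m.h2 d / 2) +
        a d * (m.lam d * (π d * m.h1 d) - m.c d * (π d - S.p0 d)))) /
        (m.cInf π * (1 - m.rhoInf π)) := by
  have hφ : ∀ n, m.cInf π * (1 - m.rhoInf π) *
      ∫ ω, truncId (truncLevel n) (S.V ω) ∂P =
      ∑ d, (1 * m.lam d * S.secondOrderTerm n d +
        a d * (m.lam d * S.jumpTerm n d - m.c d * S.drainTerm n d)) := by
    intro n
    have h := S.sum_trunc_eq_zero hS a 1 n
    rw [Finset.sum_add_distrib] at h
    have hcoef : ∀ d, ∑ l, m.Q d l * a l + 1 * (m.lam d * m.h1 d - m.c d) =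
        -(m.cInf π * (1 - m.rhoInf π)) := fun d => by rw [ha d]; ring
    simp_rw [hcoef, ← Finset.mul_sum] at h
    rw [← integral_finsetSum _ fun d _ => S.integrable_startsIn_mul (S.integrable_truncId_V n)]
      at h
    simp_rw [fun ω => S.sum_startsIn_mul (fun _ => truncId (truncLevel n) (S.V ω)) ω] at h
    linarith
  have hlim : Filter.Tendsto (fun n => ∫ ω, truncId (truncLevel n) (S.V ω) ∂P) Filter.atTop
      (nhds ((∑ d, (m.lam d * (π d * m.h2 d / 2) +
        a d * (m.lam d * (π d * m.h1 d) - m.c d * (π d - S.p0 d)))) /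
        (m.cInf π * (1 - m.rhoInf π)))) := by
    have h := (S.tendsto_lowerOrder hS hπ a 1).div_const (m.cInf π * (1 - m.rhoInf π))
    simp_rw [← hφ, mul_div_cancel_left₀ _ hρ.ne', one_mul] at h
    exact h
  have hnn : ∀ n ω, 0 ≤ truncId (truncLevel n) (S.V ω) := fun n ω =>
    truncId_nonneg (truncLevel_pos n).le (S.V_nonneg ω)
  have hint : Integrable S.V P := by
    refine ⟨S.measurable_V.aestronglyMeasurable, ?_⟩
    rw [hasFiniteIntegral_iff_ofReal (.of_forall S.V_nonneg)]
    -- The truncated means converge to a finite limit by `hlim`, so Fatou's lemma bounds the mean of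
    -- V, which then dominates its own truncations.
    have hfatou := lintegral_liminf_le (μ := P) (u := Filter.atTop)
      (f := fun n ω => ENNReal.ofReal (truncId (truncLevel n) (S.V ω)))
      fun n => ((measurable_truncId _).comp S.measurable_V).ennreal_ofReal
    have hpt : ∀ ω, Filter.liminf
        (fun n => ENNReal.ofReal (truncId (truncLevel n) (S.V ω))) Filter.atTop =
        ENNReal.ofReal (S.V ω) := fun ω =>
      (ENNReal.tendsto_ofReal (tendsto_truncId (S.V ω))).liminf_eq
    simp_rw [hpt, fun n => (ofReal_integral_eq_lintegral_ofReal (S.integrable_truncId_V n)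
      (.of_forall (hnn n))).symm] at hfatou
    rw [(ENNReal.tendsto_ofReal hlim).liminf_eq] at hfatou
    exact hfatou.trans_lt ENNReal.ofReal_lt_top
  refine ⟨hint, tendsto_nhds_unique ?_ hlim⟩
  refine tendsto_integral_of_dominated_convergence S.V
    (fun n => (S.integrable_truncId_V n).1) hint (fun n => .of_forall fun ω => ?_)
    (.of_forall fun ω => tendsto_truncId (S.V ω))
  rw [Real.norm_of_nonneg (hnn n ω)]
  exact truncId_le (truncLevel_pos n).le (S.V_nonneg ω)

end ModulatedQueue.Realization

end

theorem mainTheorem3 {D : ℕ} (m : ModulatedQueue D) (π : Fin D → ℝ)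
    (hπ : m.IsInvariantDistribution π) (hc : 0 < m.cInf π)
    {Ω : Type*} [MeasurableSpace Ω] (P : Measure Ω) [IsProbabilityMeasure P]
    (S : m.Realization P) (hS : S.IsStationary) :
    1 - m.rhoInf π = ∑ d, S.p0 d * m.c d / m.cInf π ∧
    (∃ a : Fin D → ℝ, m.SolvesQ π a) ∧
    (m.rhoInf π < 1 → ∀ a : Fin D → ℝ, m.SolvesQ π a →
      Integrable (S.W 0) P ∧
      ∫ ω, S.W 0 ω ∂P =
        (∑ d, (π d * m.lam d * m.h2 d / 2 + a d * π d * (m.lam d * m.h1 d - m.c d)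
          + S.p0 d * m.c d * a d)) / (m.cInf π * (1 - m.rhoInf π))) := by
  refine ⟨?_, m.exists_solvesQ hπ hc, fun hρ a ha => ?_⟩
  · rw [← Finset.sum_div, S.sum_p0_mul_c hS hπ, ← m.cInf_mul_one_sub_rhoInf hc,
      mul_div_cancel_left₀ _ hc.ne']
  · have hWV : S.V =ᵐ[P] S.W 0 := by
      filter_upwards [S.ae_isGood] with ω h
      exact h.W_zero_eq_V.symm
    obtain ⟨hint, heq⟩ :=
      S.integrable_V_and_integral hS hπ (mul_pos hc (sub_pos.2 hρ)) ha
    refine ⟨hint.congr hWV, ?_⟩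
    rw [← integral_congr_ae hWV, heq]
    congr 1
    exact Finset.sum_congr rfl fun d _ => by ring
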